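/- Let $\mathbb N=\{1,2,\dots\}$ and $\mathbb N_0=\mathbb N\cup\{0\}$. For real $M>16$ and $k=1,\dots,8$ put $$x_k=\frac{\frac12+\frac kM}{1-\frac{2k}M},\quad t(k)=\frac12-\frac kM,\quad u(k)=1-x_8+x_k,\quad v(k)=1+x_1^2-x_k^2,$$ $$\delta_M=x_8^2-x_1^2,\qquad \mu_M=\min_{1\le j\ne k\le 8}\big\{(1-t(k))(u(k)-u(j))+t(k)(v(k)-v(j))\big\}.$$ Call real numbers $\delta,M,\Delta$ admissible if $0<\delta<\frac1{10}$, $M>16$, $\frac8M+\delta_M+\mu_M<\frac{1-8\delta}6$, $\delta_M<\frac\delta3$ and $$0<\Delta<\min\Big\{\frac{\mu_M}2,\ \frac\delta6,\ \frac{1-2\delta}3-\delta_M,\ \delta_M,\ \frac{1-\delta_M}2\Big\}.$$ Given $\Delta$, let $\delta_i(k)=\Delta$ if $k=i$ and $\delta_i(k)=0$ if $k\neq i$ ($i,k=1,\dots,8$). Call a sequence $(e_n)_{n\in\mathbb N}$ of norm-one vectors of $\ell_\infty(\mathbb N)$ an isometric $\ell_1$-sequence if $\|\sum_n\lambda_ne_n\|=\sum_n|\lambda_n|$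 for all finitely supported real sequences $(\lambda_n)$. Given such constants and such a sequence, define $U_i,V_{i,n}\in\ell_\infty(\mathbb N^2)$ for $i=1,2$ and $n\in\mathbb N$ by $$U_i(x)=\begin{cases}u(k)&\text{if }x=(1,8m+k),\ m\in\mathbb N_0,\ m\equiv i-1\ (\mathrm{mod}\ 2),\ 1\le k\le8,\\ \delta_8(k)&\text{if }x=(1,8m+k),\ m\in\mathbb N_0,\ m\equiv i\ (\mathrm{mod}\ 2),\ 1\le k\le8,\\ \frac1{10}e_1(k)&\text{if }x=(p,k),\ p\ge2,\ k\in\mathbb N,\end{cases}$$ $$V_{i,n}(x)=\begin{cases}(-1)^{i-1}\big(\frac{1-\delta}3-\delta_{i+1}(k)\big)&\text{if }x=(1,8n+k),\ 1\le k\le8,\\ v(k)-\frac{2+2\delta}3+(-1)^i\delta_7(k)&\text{if }x=(1,8(n+1)+k),\ 1\le k\le8,\\ (-1)^{i-1}\big(\frac{1-2\delta}3-\delta_6(k)\big)&\text{if }x=(1,8m+k),\ m\in\mathbb N_0\setminus\{n\},\ m\equiv n\ (\mathrm{mod}\ 2),\ 1\le k\le8,\\ (-1)^{i-1}\frac{1-\delta}3e_1(k)&\text{if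 }x=(2n+i-1,k),\ k\in\mathbb N,\\ \frac1{10}e_{2n+i-1}(k)&\text{if }x=(p,k),\ p\ge2,\ p\notin\{2n+i-1,\,2n+2,\,2n+3\},\ k\in\mathbb N,\\ 0&\text{elsewhere,}\end{cases}$$ and let $X$ be the closed linear span of $\{U_1,U_2\}\cup\{V_{i,n}:i=1,2,\ n\in\mathbb N\}$ in $\ell_\infty(\mathbb N^2)$, with the supremum norm. **Theorem.** Admissible constants $\delta,M,\Delta$ and isometric $\ell_1$-sequences in $\ell_\infty(\mathbb N)$ exist. For every choice of them, $X$ is a separable Banach space, and there is a constant $\lambda>1$ such that there is no $\lambda$-Lipschitz retraction from $X$ onto any compact convex subset of $X$ whose closed linear span is $X$. (A retraction from $X$ onto $K\subset X$ is a map $R:X\to K$ with $R(x)=x$ for all $x\in K$.) -/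

import Mathlib

open scoped NNReal ENNReal

noncomputable section

namespace LipRetraction

/-- The real Banach space `ℓ∞(Γ)` of bounded real functions on `Γ` with the supremum norm. -/
abbrev LInf (Γ : Type) : Type := lp (fun _ : Γ => ℝ) ∞

/-! The natural numbers start from `1` here, so sequences and coordinates are indexed by `ℕ+`.
An index `k` in `{1, …, 8}` is written as a natural number. -/

/-- `x_k = (1/2 + k/M) / (1 - 2k/M)`. -/
def xk (M : ℝ) (k : ℕ) : ℝ := (1 / 2 + (k : ℝ) / M) / (1 - 2 * (k : ℝ) / M)

/-- `t(k) = 1/2 - k/M`. -/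
def tk (M : ℝ) (k : ℕ) : ℝ := 1 / 2 - k / M

/-- `α = 1 - x_8`. -/
def alpha (M : ℝ) : ℝ := 1 - xk M 8

/-- `β = 1 + x_1 ^ 2`. -/
def beta (M : ℝ) : ℝ := 1 + xk M 1 ^ 2

/-- `u(k) = f(x_k)` with `f(x) = α + x`. -/
def uk (M : ℝ) (k : ℕ) : ℝ := alpha M + xk M k

/-- `v(k) = g(x_k)` with `g(x) = β - x ^ 2`. -/
def vk (M : ℝ) (k : ℕ) : ℝ := beta M - xk M k ^ 2

/-- `δ_i(k)`, which is `Δ` if `k = i` and `0` otherwise. -/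
def bump (Δ : ℝ) (i k : ℕ) : ℝ := if k = i then Δ else 0

/-- `δ_M = x_8 ^ 2 - x_1 ^ 2`. -/
def deltaM (M : ℝ) : ℝ := xk M 8 ^ 2 - xk M 1 ^ 2

/-- `μ_M`, the minimum over `j ≠ k` in `{1, …, 8}` of
`(1 - t(k)) (u(k) - u(j)) + t(k) (v(k) - v(j))`. -/
def muM (M : ℝ) : ℝ :=
  ((Finset.Icc 1 8).offDiag).inf' (by decide) fun p : ℕ × ℕ =>
    (1 - tk M p.2) * (uk M p.2 - uk M p.1) + tk M p.2 * (vk M p.2 - vk M p.1)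

/-- The conditions on the three constants `δ`, `M`, `Δ` of the construction. -/
structure Admissible (δ M Δ : ℝ) : Prop where
  delta_pos : 0 < δ
  delta_lt : δ < 1 / 10
  M_gt : 16 < M
  M_large : 8 / M + deltaM M + muM M < (1 - 8 * δ) / 6
  deltaM_lt : deltaM M < δ / 3
  Delta_pos : 0 < Δ
  Delta_lt_muM : Δ < muM M / 2
  Delta_lt_delta : Δ < δ / 6
  Delta_lt_sub : Δ < (1 - 2 * δ) / 3 - deltaM M
  Delta_lt_deltaM : Δ < deltaM M
  Delta_lt_half : Δ < (1 - deltaM M) / 2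

/-- A sequence of norm-one vectors of `ℓ∞(ℕ)` that is isometrically equivalent to the unit
vector basis of `ℓ₁(ℕ)`. -/
def IsL1Basis (e : ℕ+ → LInf ℕ+) : Prop :=
  (∀ n, ‖e n‖ = 1) ∧
    ∀ a : ℕ+ →₀ ℝ, ‖a.sum fun n c => c • e n‖ = a.sum fun _ c => |c|

/-- The number `m ≥ 0` of the block containing `q = 8 m + k`, `1 ≤ k ≤ 8`. -/
def blk (q : ℕ+) : ℕ := ((q : ℕ) - 1) / 8

/-- The place `k ∈ {1, …, 8}` of `q = 8 m + k` inside its block. -/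
def pos (q : ℕ+) : ℕ := ((q : ℕ) - 1) % 8 + 1

theorem eight_mul_blk_add_pos (q : ℕ+) : 8 * blk q + pos q = q := by
  have := q.pos
  unfold blk pos
  omega

theorem pos_mem (q : ℕ+) : pos q ∈ Finset.Icc 1 8 := by
  unfold pos
  rw [Finset.mem_Icc]
  omega

/-! The index `i ∈ {1, 2}` is represented by `i : Fin 2`, whose value is one less: `0` stands for
`i = 1` and `1` stands for `i = 2`. -/

/-- The number `2 n + i - 1` (with `i ∈ {1, 2}`). -/
def idx (i : Fin 2) (n : ℕ+) : ℕ+ := ⟨2 * (n : ℕ) + (i : ℕ), by have := n.pos; omega⟩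

/-- The coordinates of `U_i`. In the first row they are `u(k)` at place `k` of the blocks whose
number has the parity of `i - 1`, and `δ_8(k)` in the other blocks; every other row is
`e_1 / 10`. -/
def Ufun (M Δ : ℝ) (e : ℕ+ → LInf ℕ+) (i : Fin 2) (x : ℕ+ × ℕ+) : ℝ :=
  if x.1 = 1 then
    if blk x.2 % 2 = (i : ℕ) then uk M (pos x.2) else bump Δ 8 (pos x.2)
  else 1 / 10 * e 1 x.2

/-- The coordinates of `V_{i,n}`. -/
def Vfun (δ M Δ : ℝ) (e : ℕ+ → LInf ℕ+) (i : Fin 2) (n : ℕ+) (x : ℕ+ × ℕ+) : ℝ :=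
  if x.1 = 1 then
    if blk x.2 = (n : ℕ) then (-1) ^ (i : ℕ) * ((1 - δ) / 3 - bump Δ ((i : ℕ) + 2) (pos x.2))
    else if blk x.2 = (n : ℕ) + 1 then
      vk M (pos x.2) - (2 + 2 * δ) / 3 + (-1) ^ ((i : ℕ) + 1) * bump Δ 7 (pos x.2)
    else if blk x.2 % 2 = (n : ℕ) % 2 then
      (-1) ^ (i : ℕ) * ((1 - 2 * δ) / 3 - bump Δ 6 (pos x.2))
    else 0
  else if x.1 = idx i n then (-1) ^ (i : ℕ) * ((1 - δ) / 3) * e 1 x.2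
  else if x.1 = 2 * (n + 1) ∨ x.1 = 2 * (n + 1) + 1 then 0
  else 1 / 10 * e (idx i n) x.2

theorem exists_bound_pos (h : ℕ → ℝ) : ∃ C, 0 ≤ C ∧ ∀ q, |h (pos q)| ≤ C :=
  ⟨∑ k ∈ Finset.Icc 1 8, |h k|, Finset.sum_nonneg fun _ _ => abs_nonneg _, fun q =>
    Finset.single_le_sum (f := fun k => |h k|) (fun _ _ => abs_nonneg _) (pos_mem q)⟩

theorem exists_bound_mul (c : ℝ) (w : LInf ℕ+) : ∃ C, 0 ≤ C ∧ ∀ q, |c * w q| ≤ C :=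
  ⟨|c| * ‖w‖, by positivity, fun q => by
    rw [abs_mul]
    exact mul_le_mul_of_nonneg_left (lp.norm_apply_le_norm ENNReal.top_ne_zero w q)
      (abs_nonneg c)⟩

theorem memlp_Ufun (M Δ : ℝ) (e : ℕ+ → LInf ℕ+) (i : Fin 2) :
    Memℓp (E := fun _ : ℕ+ × ℕ+ => ℝ) (Ufun M Δ e i) ∞ := by
  obtain ⟨A, hA, hA'⟩ := exists_bound_pos (uk M)
  obtain ⟨B, hB, hB'⟩ := exists_bound_pos (bump Δ 8)
  obtain ⟨C, hC, hC'⟩ := exists_bound_mul (1 / 10) (e 1)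
  refine memℓp_infty ⟨A + B + C, ?_⟩
  rintro _ ⟨x, rfl⟩
  have h1 := hA' x.2
  have h2 := hB' x.2
  have h3 := hC' x.2
  simp only [Real.norm_eq_abs, Ufun]
  split_ifs <;> linarith

theorem memlp_Vfun (δ M Δ : ℝ) (e : ℕ+ → LInf ℕ+) (i : Fin 2) (n : ℕ+) :
    Memℓp (E := fun _ : ℕ+ × ℕ+ => ℝ) (Vfun δ M Δ e i n) ∞ := by
  obtain ⟨A, hA, hA'⟩ := exists_bound_pos fun k =>
    (-1) ^ (i : ℕ) * ((1 - δ) / 3 - bump Δ ((i : ℕ) + 2) k)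
  obtain ⟨B, hB, hB'⟩ := exists_bound_pos fun k =>
    vk M k - (2 + 2 * δ) / 3 + (-1) ^ ((i : ℕ) + 1) * bump Δ 7 k
  obtain ⟨C, hC, hC'⟩ := exists_bound_pos fun k =>
    (-1) ^ (i : ℕ) * ((1 - 2 * δ) / 3 - bump Δ 6 k)
  obtain ⟨D, hD, hD'⟩ := exists_bound_mul ((-1) ^ (i : ℕ) * ((1 - δ) / 3)) (e 1)
  obtain ⟨E, hE, hE'⟩ := exists_bound_mul (1 / 10) (e (idx i n))
  refine memℓp_infty ⟨A + B + C + D + E, ?_⟩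
  rintro _ ⟨x, rfl⟩
  have h1 := hA' x.2
  have h2 := hB' x.2
  have h3 := hC' x.2
  have h4 := hD' x.2
  have h5 := hE' x.2
  simp only [Real.norm_eq_abs, Vfun]
  split_ifs <;> first | linarith | (rw [abs_zero]; linarith)

/-- The vector `U_i` of `ℓ∞(ℕ²)`. -/
def U (M Δ : ℝ) (e : ℕ+ → LInf ℕ+) (i : Fin 2) : LInf (ℕ+ × ℕ+) :=
  ⟨Ufun M Δ e i, memlp_Ufun M Δ e i⟩

/-- The vector `V_{i,n}` of `ℓ∞(ℕ²)`. -/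
def V (δ M Δ : ℝ) (e : ℕ+ → LInf ℕ+) (i : Fin 2) (n : ℕ+) : LInf (ℕ+ × ℕ+) :=
  ⟨Vfun δ M Δ e i n, memlp_Vfun δ M Δ e i n⟩

/-- The space `X`: the closed linear span in `ℓ∞(ℕ²)` of all the vectors `V_{i,n}` and `U_i`,
with the norm of `ℓ∞(ℕ²)`. -/
def X (δ M Δ : ℝ) (e : ℕ+ → LInf ℕ+) : Submodule ℝ (LInf (ℕ+ × ℕ+)) :=
  (Submodule.span ℝ
    ((Set.range fun p : Fin 2 × ℕ+ => V δ M Δ e p.1 p.2) ∪ Set.range (U M Δ e))).topologicalClosure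

/-- A subset is generating if its closed linear span is the whole space. -/
def IsGenerating {E : Type*} [NormedAddCommGroup E] [NormedSpace ℝ E] (S : Set E) : Prop :=
  (Submodule.span ℝ S).topologicalClosure = ⊤

/-- `R` is a retraction from the whole space onto `K`. -/
def IsRetractionOnto {E : Type*} (R : E → E) (K : Set E) : Prop :=
  (∀ x, R x ∈ K) ∧ ∀ x ∈ K, R x = x

end LipRetraction

end

/-! The coordinates of the first row come in blocks of eight places. On the block `n + 1` the pair
`(U_i, V_{1,n} + V_{2,n})` runs, up to affine changes, through eight points `(u(k), v(k))` of a
parabola, and the combination with weights `1 - t(k)` and `t(k)` is supported exactly at place `k`.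
This yields elements whose absolute value peaks at a single prescribed coordinate, with a gap `Δ`
to all other coordinates (`abs_ev_peak_le`, `abs_ev_moving_le`).

Let `ρ` be a `(1 + κ)`-Lipschitz retraction onto a compact convex set `K`. If `y` and `-y` are close
to `K` and `y ± x` still peak at the coordinate `q` of the peak of `y`, then the inequalities `‖ρ(x)
- y‖ ≤ (1 + κ) ‖x - y‖` and `‖ρ(x) + y‖ ≤ (1 + κ) ‖x + y‖`, which hold up to a small error, force
`ρ(x)` to agree almost with `x` at `q` (`ev_sub_le_of_norm_le`). The bumps `δ_i` make the values of
the generators at the eight places of a block independent, so the first row on a block determines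
the coefficients that matter there (`exists_coeff_bound`); all other coefficients are controlled by
the lower rows, where the sequence `(e_n)` gives the norm of `ℓ₁` (`row_le_norm_comb`). So `ρ(x)` is
close to `x` as soon as this is known at finitely many coordinates and for the norm of one row
(`exists_close_bound`).

The decisive point is that the element that peaks on the block `n + 1`, where it exposes
`V_{i,n+1}`, contains `V_{1,n}` and `V_{2,n}` with coefficients `t(k)` of sum less than `1`. If `K`
contains points at distance at most `Δ / 8` from `± V_{i,n}` and from some large multiples of `±
U_j`, it therefore also approximates `±` this element up to `Δ / 8`, and that does not destroy the
peak (`Exposed.abs_ev_sub_le_succ`). Hence `V_{i,n+1}` is almost fixed, with an error that depends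
on `κ` but not on the quality of the approximation of `V_{i,n}`, and is at most `Δ / 8` for suitable
constants. By induction `K` comes within `Δ / 8` of all `V_{1,n}` with `n` large
(`exists_constants`). These contain an infinite separated set, so that `K` is not compact.

For the start of the induction a given generating set is blown up around one of its points until it
contains good approximations of finitely many prescribed directions
(`exists_forall_add_smul_mem`). A generating set may lie in a hyperplane that misses `0`, and then
its directions are dense only in the kernel of a functional (`exists_functional_directions`);
`exists_exposers_near_ker` chooses the finitely many peaking elements close to this kernel. -/

open scoped NNReal ENNReal

noncomputable section

namespace LipRetraction

/-! ### The constants -/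

section Constants

theorem tk_pos {M : ℝ} (hM : 16 < M) {k : ℕ} (hk : k ≤ 8) : 0 < tk M k := by
  have hk' : (k : ℝ) ≤ 8 := by exact_mod_cast hk
  have : (k : ℝ) / M < 1 / 2 := by
    rw [div_lt_iff₀ (by linarith)]
    linarith
  unfold tk
  linarith

theorem xk_eq {M : ℝ} (hM : 16 < M) {k : ℕ} (hk : k ≤ 8) :
    xk M k = 1 / (2 * tk M k) - 1 / 2 := by
  have h := tk_pos hM hk
  have h1 : 1 - 2 * (k : ℝ) / M = 2 * tk M k := by unfold tk; ring
  have h2 : 1 / 2 + (k : ℝ) / M = 1 - tk M k := by unfold tk; ring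
  rw [xk, h1, h2]
  field_simp

theorem two_mul_tk_mul_xk {M : ℝ} (hM : 16 < M) {k : ℕ} (hk : k ≤ 8) :
    2 * tk M k * xk M k = 1 - tk M k := by
  have h := tk_pos hM hk
  rw [xk_eq hM hk]
  field_simp

theorem xk_lt_xk {M : ℝ} (hM : 16 < M) {j k : ℕ} (hjk : j < k) (hk : k ≤ 8) :
    xk M j < xk M k := by
  rw [xk_eq hM (hjk.le.trans hk), xk_eq hM hk]
  have h1 := tk_pos hM hk
  have h2 : tk M k < tk M j := by
    have : (j : ℝ) < k := by exact_mod_cast hjk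
    unfold tk
    have := div_lt_div_of_pos_right this (show 0 < M by linarith)
    linarith
  have : 1 / (2 * tk M j) < 1 / (2 * tk M k) := by
    apply one_div_lt_one_div_of_lt <;> linarith
  linarith

theorem xk_le_xk {M : ℝ} (hM : 16 < M) {j k : ℕ} (hjk : j ≤ k) (hk : k ≤ 8) :
    xk M j ≤ xk M k := by
  rcases hjk.eq_or_lt with rfl | h
  · exact le_rfl
  · exact (xk_lt_xk hM h hk).le

theorem half_lt_xk {M : ℝ} (hM : 16 < M) {k : ℕ} (hk1 : 1 ≤ k) (hk : k ≤ 8) :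
    1 / 2 < xk M k := by
  rw [xk_eq hM hk]
  have h1 := tk_pos hM hk
  have h2 : tk M k < 1 / 2 := by
    have : (1 : ℝ) ≤ k := by exact_mod_cast hk1
    have : 0 < (k : ℝ) / M := by
      apply div_pos <;> linarith
    unfold tk
    linarith
  have : 1 < 1 / (2 * tk M k) := by
    rw [lt_div_iff₀ (by linarith)]
    linarith
  linarith

/-- The curve `x ↦ (u, v)` is a parabola, and the line of slope `t(k)` supports it at the place
`k`: the quantity minimised in `μ_M` is a multiple of `(x_k - x_j)²`. -/
theorem support_eq {M : ℝ} (hM : 16 < M) (j : ℕ) {k : ℕ} (hk : k ≤ 8) :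
    (1 - tk M k) * (uk M k - uk M j) + tk M k * (vk M k - vk M j) =
      tk M k * (xk M k - xk M j) ^ 2 := by
  rw [← two_mul_tk_mul_xk hM hk]
  unfold uk vk
  ring

theorem muM_le {M : ℝ} {j k : ℕ} (hj : j ∈ Finset.Icc 1 8) (hk : k ∈ Finset.Icc 1 8)
    (hjk : j ≠ k) :
    muM M ≤ (1 - tk M k) * (uk M k - uk M j) + tk M k * (vk M k - vk M j) :=
  Finset.inf'_le (fun p : ℕ × ℕ =>
    (1 - tk M p.2) * (uk M p.2 - uk M p.1) + tk M p.2 * (vk M p.2 - vk M p.1))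
    (b := (j, k)) (Finset.mem_offDiag.2 ⟨hj, hk, hjk⟩)

theorem muM_pos {M : ℝ} (hM : 16 < M) : 0 < muM M := by
  unfold muM
  rw [Finset.lt_inf'_iff]
  rintro ⟨j, k⟩ hp
  rw [Finset.mem_offDiag] at hp
  obtain ⟨hj, hk, hjk⟩ := hp
  simp only [Finset.mem_Icc] at hj hk hjk
  dsimp only
  rw [support_eq hM j hk.2]
  have h1 := tk_pos hM hk.2
  have h2 : xk M k - xk M j ≠ 0 := by
    rcases Nat.lt_or_gt_of_ne hjk with h | h
    · have := xk_lt_xk hM h hk.2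
      exact ne_of_gt (by linarith)
    · have := xk_lt_xk hM h hj.2
      exact ne_of_lt (by linarith)
  positivity

theorem deltaM_pos {M : ℝ} (hM : 16 < M) : 0 < deltaM M := by
  have h1 := xk_lt_xk hM (show 1 < 8 by norm_num) le_rfl
  have h2 := half_lt_xk hM (le_refl 1) (by norm_num)
  unfold deltaM
  nlinarith

theorem uk_le_one {M : ℝ} (hM : 16 < M) {k : ℕ} (hk : k ∈ Finset.Icc 1 8) : uk M k ≤ 1 := by
  rw [Finset.mem_Icc] at hk
  have := xk_le_xk hM hk.2 le_rfl
  unfold uk alpha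
  linarith

theorem le_uk {M : ℝ} (hM : 16 < M) {k : ℕ} (hk : k ∈ Finset.Icc 1 8) :
    1 - deltaM M ≤ uk M k := by
  rw [Finset.mem_Icc] at hk
  have h1 := xk_le_xk hM hk.1 hk.2
  have h2 := half_lt_xk hM (le_refl 1) (by norm_num)
  have h3 := xk_le_xk hM (show 1 ≤ 8 by norm_num) le_rfl
  unfold uk alpha deltaM
  nlinarith

theorem vk_le_one {M : ℝ} (hM : 16 < M) {k : ℕ} (hk : k ∈ Finset.Icc 1 8) : vk M k ≤ 1 := by
  rw [Finset.mem_Icc] at hk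
  have h1 := xk_le_xk hM hk.1 hk.2
  have h2 := half_lt_xk hM (le_refl 1) (by norm_num)
  unfold vk beta
  nlinarith

theorem le_vk {M : ℝ} (hM : 16 < M) {k : ℕ} (hk : k ∈ Finset.Icc 1 8) :
    1 - deltaM M ≤ vk M k := by
  rw [Finset.mem_Icc] at hk
  have h1 := xk_le_xk hM hk.2 le_rfl
  have h2 := half_lt_xk hM hk.1 hk.2
  unfold vk beta deltaM
  nlinarith

variable {δ M Δ : ℝ}

theorem Admissible.eight_div_lt (h : Admissible δ M Δ) : 8 / M < 1 / 6 := by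
  have h1 := h.M_large
  have h2 := deltaM_pos h.M_gt
  have h3 := muM_pos h.M_gt
  have h4 := h.delta_pos
  linarith

theorem Admissible.le_tk (h : Admissible δ M Δ) {k : ℕ} (hk : k ∈ Finset.Icc 1 8) :
    1 / 2 - 8 / M ≤ tk M k := by
  rw [Finset.mem_Icc] at hk
  have hk' : (k : ℝ) ≤ 8 := by exact_mod_cast hk.2
  have hM := h.M_gt
  have := div_le_div_of_nonneg_right hk' (show 0 ≤ M by linarith)
  unfold tk
  linarith

theorem Admissible.third_lt_tk (h : Admissible δ M Δ) {k : ℕ} (hk : k ∈ Finset.Icc 1 8) :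
    1 / 3 < tk M k := by
  have := h.le_tk hk
  have := h.eight_div_lt
  linarith

theorem Admissible.tk_lt_half (h : Admissible δ M Δ) {k : ℕ} (hk : k ∈ Finset.Icc 1 8) :
    tk M k < 1 / 2 := by
  rw [Finset.mem_Icc] at hk
  have hM := h.M_gt
  have : (1 : ℝ) ≤ k := by exact_mod_cast hk.1
  have : 0 < (k : ℝ) / M := by
    apply div_pos <;> linarith
  unfold tk
  linarith

/-- The height by which a block carrying `v` beats the other blocks of the same parity. -/
theorem Admissible.block_gap (h : Admissible δ M Δ) {k : ℕ} (hk : k ∈ Finset.Icc 1 8) :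
    muM M + δ ≤ tk M k * (1 - 2 * δ) / 3 - deltaM M := by
  have h1 := h.le_tk hk
  have h2 := h.M_large
  have h3 : 0 < 8 / M := div_pos (by norm_num) (by linarith [h.M_gt])
  have h4 := h.delta_pos
  have h5 := h.delta_lt
  nlinarith

theorem exists_admissible : ∃ δ M Δ : ℝ, Admissible δ M Δ := by
  have hM : (16 : ℝ) < 10000 := by norm_num
  have hμ := muM_pos hM
  have hd := deltaM_pos hM
  have hd' : deltaM 10000 < 1 / 100 := by norm_num [deltaM, xk]
  have hμ' : muM 10000 < 1 / 100 := by
    refine (muM_le (j := 1) (k := 2) (by decide) (by decide) (by decide)).trans_lt ?_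
    norm_num [tk, uk, vk, alpha, beta, xk]
  obtain ⟨Δ, h0, h1⟩ := exists_between
    (lt_min (half_pos hμ) (lt_min hd (by norm_num : (0 : ℝ) < 1 / 200)))
  rw [lt_min_iff, lt_min_iff] at h1
  refine ⟨1 / 20, 10000, Δ, ?_, ?_, ?_, ?_, ?_, ?_, ?_, ?_, ?_, ?_, ?_⟩ <;> norm_num <;> linarith

end Constants

/-! ### Coordinates of the generators -/

section Coordinates

variable {δ M Δ : ℝ} {e : ℕ+ → LInf ℕ+}

/-- The position `8 b + k` of place `k ≥ 1` in the block `b`. -/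
def cell (b k : ℕ) : ℕ+ := ⟨8 * b + (k - 1) + 1, Nat.succ_pos _⟩

theorem blk_cell (b : ℕ) {k : ℕ} (hk : k ∈ Finset.Icc 1 8) : blk (cell b k) = b := by
  rw [Finset.mem_Icc] at hk
  simp only [blk, cell, PNat.mk_coe]
  omega

theorem pos_cell (b : ℕ) {k : ℕ} (hk : k ∈ Finset.Icc 1 8) : pos (cell b k) = k := by
  rw [Finset.mem_Icc] at hk
  simp only [pos, cell, PNat.mk_coe]
  omega

theorem eq_cell {q : ℕ+} {b k : ℕ} (hb : blk q = b) (hk : pos q = k) : q = cell b k := by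
  have := eight_mul_blk_add_pos q
  have h2 := pos_mem q
  rw [Finset.mem_Icc] at h2
  apply PNat.eq
  simp only [cell, PNat.mk_coe]
  omega

/-- `U_i` as an element of `X`. -/
def uX (δ M Δ : ℝ) (e : ℕ+ → LInf ℕ+) (i : Fin 2) : X δ M Δ e :=
  ⟨U M Δ e i, Submodule.le_topologicalClosure _ (Submodule.subset_span (Or.inr ⟨i, rfl⟩))⟩

/-- `V_{i,n}` as an element of `X`. -/
def vX (δ M Δ : ℝ) (e : ℕ+ → LInf ℕ+) (i : Fin 2) (n : ℕ+) : X δ M Δ e :=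
  ⟨V δ M Δ e i n, Submodule.le_topologicalClosure _ (Submodule.subset_span (Or.inl ⟨(i, n), rfl⟩))⟩

/-- The linear functional that reads off a coordinate of an element of `X`. -/
def ev (q : ℕ+ × ℕ+) : X δ M Δ e →ₗ[ℝ] ℝ where
  toFun x := (x : LInf (ℕ+ × ℕ+)) q
  map_add' _ _ := rfl
  map_smul' _ _ := rfl

theorem ev_uX (q : ℕ+ × ℕ+) (i : Fin 2) : ev q (uX δ M Δ e i) = Ufun M Δ e i q := rfl

theorem ev_vX (q : ℕ+ × ℕ+) (i : Fin 2) (n : ℕ+) :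
    ev q (vX δ M Δ e i n) = Vfun δ M Δ e i n q := rfl

theorem abs_ev_le (q : ℕ+ × ℕ+) (x : X δ M Δ e) : |ev q x| ≤ ‖x‖ :=
  lp.norm_apply_le_norm ENNReal.top_ne_zero (x : LInf (ℕ+ × ℕ+)) q

theorem norm_le_of_abs_ev_le {x : X δ M Δ e} {C : ℝ} (hC : ∀ q, |ev q x| ≤ C) : ‖x‖ ≤ C :=
  lp.norm_le_of_forall_le ((abs_nonneg _).trans (hC (1, 1))) hC

theorem bump_nonneg (hΔ : 0 ≤ Δ) (i k : ℕ) : 0 ≤ bump Δ i k := by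
  unfold bump
  split_ifs <;> simp [hΔ]

theorem bump_le (hΔ : 0 ≤ Δ) (i k : ℕ) : bump Δ i k ≤ Δ := by
  unfold bump
  split_ifs <;> simp [hΔ]

theorem IsL1Basis.abs_le (he : IsL1Basis e) (n q : ℕ+) : |e n q| ≤ 1 := by
  have := lp.norm_apply_le_norm ENNReal.top_ne_zero (e n) q
  rwa [he.1 n] at this

theorem Ufun_eq {q : ℕ+} {i : Fin 2} (hq : blk q % 2 = i) :
    Ufun M Δ e i (1, q) = uk M (pos q) := by
  simp [Ufun, hq]

theorem Ufun_ne {q : ℕ+} {i : Fin 2} (hq : blk q % 2 ≠ i) :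
    Ufun M Δ e i (1, q) = bump Δ 8 (pos q) := by
  simp [Ufun, hq]

theorem Vfun_self {q : ℕ+} {i : Fin 2} {n : ℕ+} (hq : blk q = n) :
    Vfun δ M Δ e i n (1, q) =
      (-1) ^ (i : ℕ) * ((1 - δ) / 3 - bump Δ ((i : ℕ) + 2) (pos q)) := by
  simp [Vfun, hq]

theorem Vfun_succ {q : ℕ+} {i : Fin 2} {n : ℕ+} (hq : blk q = n + 1) :
    Vfun δ M Δ e i n (1, q) =
      vk M (pos q) - (2 + 2 * δ) / 3 + (-1) ^ ((i : ℕ) + 1) * bump Δ 7 (pos q) := by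
  simp [Vfun, hq]

theorem Vfun_parity {q : ℕ+} {i : Fin 2} {n : ℕ+} (h1 : blk q ≠ n)
    (h3 : blk q % 2 = (n : ℕ) % 2) :
    Vfun δ M Δ e i n (1, q) = (-1) ^ (i : ℕ) * ((1 - 2 * δ) / 3 - bump Δ 6 (pos q)) := by
  have h2 : blk q ≠ n + 1 := by omega
  simp [Vfun, h1, h2, h3]

theorem Vfun_other {q : ℕ+} {i : Fin 2} {n : ℕ+} (h2 : blk q ≠ n + 1)
    (h3 : blk q % 2 ≠ (n : ℕ) % 2) : Vfun δ M Δ e i n (1, q) = 0 := by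
  have h1 : blk q ≠ n := by rintro h; simp [h] at h3
  simp [Vfun, h1, h2, h3]

theorem abs_Ufun_le (he : IsL1Basis e) {p : ℕ+} (hp : p ≠ 1) (q : ℕ+) (i : Fin 2) :
    |Ufun M Δ e i (p, q)| ≤ 1 / 10 := by
  simp only [Ufun, hp, if_false, abs_mul]
  have := he.abs_le 1 q
  rw [abs_of_pos (by norm_num : (0 : ℝ) < 1 / 10)]
  linarith

theorem idx_ne_one (i : Fin 2) (n : ℕ+) : idx i n ≠ 1 := by
  intro h
  have h1 : 2 * (n : ℕ) + i = 1 := congrArg PNat.val h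
  have := n.pos
  omega

theorem idx_injective {i j : Fin 2} {m n : ℕ+} (h : idx i m = idx j n) : i = j ∧ m = n := by
  have h1 : 2 * (m : ℕ) + i = 2 * (n : ℕ) + j := congrArg PNat.val h
  refine ⟨Fin.ext (by omega), PNat.eq (by omega)⟩

theorem abs_Vfun_idx_le (h : Admissible δ M Δ) (he : IsL1Basis e) (i : Fin 2) (n q : ℕ+) :
    |Vfun δ M Δ e i n (idx i n, q)| ≤ (1 - δ) / 3 := by
  have hδ := h.delta_lt
  simp only [Vfun, idx_ne_one, if_false, if_true, abs_mul, abs_pow, abs_neg, abs_one, one_pow]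
  have := he.abs_le 1 q
  rw [abs_of_pos (by linarith : 0 < (1 - δ) / 3)]
  nlinarith

theorem abs_Vfun_le_tenth (he : IsL1Basis e) {i : Fin 2} {n p : ℕ+} (hp : p ≠ 1)
    (hp' : p ≠ idx i n) (q : ℕ+) : |Vfun δ M Δ e i n (p, q)| ≤ 1 / 10 := by
  simp only [Vfun, hp, hp', if_false]
  split_ifs
  · norm_num
  · have := he.abs_le (idx i n) q
    rw [abs_mul, abs_of_pos (by norm_num : (0 : ℝ) < 1 / 10)]
    linarith

theorem abs_Vfun_le_third (h : Admissible δ M Δ) (he : IsL1Basis e) (i : Fin 2) (n : ℕ+)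
    {p : ℕ+} (hp : p ≠ 1) (q : ℕ+) : |Vfun δ M Δ e i n (p, q)| ≤ 1 / 3 := by
  by_cases hp' : p = idx i n
  · subst hp'
    have := abs_Vfun_idx_le h he i n q
    have := h.delta_pos
    linarith
  · have := abs_Vfun_le_tenth (δ := δ) (M := M) (Δ := Δ) he hp hp' q
    linarith

theorem sign_cases (i : Fin 2) : ((-1 : ℝ) ^ (i : ℕ) = 1 ∧ (-1 : ℝ) ^ ((i : ℕ) + 1) = -1) ∨
    ((-1 : ℝ) ^ (i : ℕ) = -1 ∧ (-1 : ℝ) ^ ((i : ℕ) + 1) = 1) := by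
  fin_cases i <;> simp

theorem abs_Vfun_row_one_le (h : Admissible δ M Δ) (i : Fin 2) (n q : ℕ+) :
    |Vfun δ M Δ e i n (1, q)| ≤ 1 / 3 := by
  have hΔ := h.Delta_pos
  have h1 := h.Delta_lt_delta
  have h2 := h.delta_lt
  have h3 := h.deltaM_lt
  have h4 := deltaM_pos h.M_gt
  by_cases hb : blk q = n
  · rw [Vfun_self hb, abs_mul, abs_pow, abs_neg, abs_one, one_pow, one_mul, abs_le]
    have := bump_nonneg hΔ.le ((i : ℕ) + 2) (pos q)
    have := bump_le hΔ.le ((i : ℕ) + 2) (pos q)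
    constructor <;> linarith
  by_cases hb' : blk q = n + 1
  · rw [Vfun_succ hb', abs_le]
    have := bump_nonneg hΔ.le 7 (pos q)
    have := bump_le hΔ.le 7 (pos q)
    have := le_vk h.M_gt (pos_mem q)
    have := vk_le_one h.M_gt (pos_mem q)
    rcases sign_cases i with ⟨_, hs⟩ | ⟨_, hs⟩ <;> rw [hs] <;> constructor <;> linarith
  by_cases hb2 : blk q % 2 = (n : ℕ) % 2
  · rw [Vfun_parity hb hb2, abs_mul, abs_pow, abs_neg, abs_one, one_pow, one_mul, abs_le]
    have := bump_nonneg hΔ.le 6 (pos q)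
    have := bump_le hΔ.le 6 (pos q)
    constructor <;> linarith
  · rw [Vfun_other hb' hb2]
    norm_num

theorem norm_uX_le (h : Admissible δ M Δ) (he : IsL1Basis e) (i : Fin 2) :
    ‖uX δ M Δ e i‖ ≤ 1 := by
  refine norm_le_of_abs_ev_le fun ⟨p, q⟩ => ?_
  rw [ev_uX]
  by_cases hp : p = 1
  · subst hp
    have h1 := h.Delta_lt_delta
    have h2 := h.delta_lt
    have h3 := h.deltaM_lt
    have := le_uk h.M_gt (pos_mem q)
    have := uk_le_one h.M_gt (pos_mem q)
    have := bump_nonneg h.Delta_pos.le 8 (pos q)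
    have := bump_le h.Delta_pos.le 8 (pos q)
    by_cases hq : blk q % 2 = i
    · rw [Ufun_eq hq, abs_le]
      constructor <;> linarith
    · rw [Ufun_ne hq, abs_le]
      constructor <;> linarith
  · exact (abs_Ufun_le he hp q i).trans (by norm_num)

theorem norm_vX_le (h : Admissible δ M Δ) (he : IsL1Basis e) (i : Fin 2) (n : ℕ+) :
    ‖vX δ M Δ e i n‖ ≤ 1 / 3 := by
  refine norm_le_of_abs_ev_le fun ⟨p, q⟩ => ?_
  rw [ev_vX]
  by_cases hp : p = 1
  · subst hp
    exact abs_Vfun_row_one_le h i n q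
  · exact abs_Vfun_le_third h he i n hp q

/-- The finite linear combination of generators with coefficients `a` at `U_1, U_2` and `b` at the
`V_{i,n}`. -/
def comb (δ M Δ : ℝ) (e : ℕ+ → LInf ℕ+) (a : Fin 2 → ℝ) (b : Fin 2 × ℕ+ →₀ ℝ) : X δ M Δ e :=
  a 0 • uX δ M Δ e 0 + a 1 • uX δ M Δ e 1 +
    Finsupp.linearCombination ℝ (fun p : Fin 2 × ℕ+ => vX δ M Δ e p.1 p.2) b

theorem comb_sub (a a' : Fin 2 → ℝ) (b b' : Fin 2 × ℕ+ →₀ ℝ) :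
    comb δ M Δ e a b - comb δ M Δ e a' b' = comb δ M Δ e (a - a') (b - b') := by
  simp only [comb, map_sub, Pi.sub_apply, sub_smul]
  abel

theorem ev_comb (q : ℕ+ × ℕ+) (a : Fin 2 → ℝ) (b : Fin 2 × ℕ+ →₀ ℝ) :
    ev q (comb δ M Δ e a b) = a 0 * Ufun M Δ e 0 q + a 1 * Ufun M Δ e 1 q +
      b.sum fun p c => c * Vfun δ M Δ e p.1 p.2 q := by
  simp only [comb, map_add, map_smul, smul_eq_mul, ev_uX, Finsupp.linearCombination_apply]
  rw [Finsupp.sum, map_sum]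
  simp only [map_smul, smul_eq_mul, ev_vX]
  rfl

theorem norm_comb_le (h : Admissible δ M Δ) (he : IsL1Basis e) (a : Fin 2 → ℝ)
    (b : Fin 2 × ℕ+ →₀ ℝ) :
    ‖comb δ M Δ e a b‖ ≤ |a 0| + |a 1| + b.sum fun _ c => |c| := by
  have h0 := norm_uX_le h he 0
  have h1 := norm_uX_le h he 1
  refine (norm_add_le _ _).trans (add_le_add ((norm_add_le _ _).trans (add_le_add ?_ ?_)) ?_)
  · rw [norm_smul, Real.norm_eq_abs]
    exact mul_le_of_le_one_right (abs_nonneg _) h0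
  · rw [norm_smul, Real.norm_eq_abs]
    exact mul_le_of_le_one_right (abs_nonneg _) h1
  · rw [Finsupp.linearCombination_apply]
    refine (norm_sum_le _ _).trans (Finset.sum_le_sum fun p _ => ?_)
    rw [norm_smul, Real.norm_eq_abs]
    have := norm_vX_le h he p.1 p.2
    exact mul_le_of_le_one_right (abs_nonneg _) (by linarith)

theorem exists_comb_near (x : X δ M Δ e) {ε : ℝ} (hε : 0 < ε) :
    ∃ a b, ‖x - comb δ M Δ e a b‖ ≤ ε := by
  have hx : (x : LInf (ℕ+ × ℕ+)) ∈ closure ((Submodule.span ℝ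
    ((Set.range fun p : Fin 2 × ℕ+ => V δ M Δ e p.1 p.2) ∪ Set.range (U M Δ e)) :
      Submodule ℝ (LInf (ℕ+ × ℕ+))) : Set (LInf (ℕ+ × ℕ+))) := x.2
  obtain ⟨y, hy, hxy⟩ := Metric.mem_closure_iff.1 hx ε hε
  rw [SetLike.mem_coe, Submodule.span_union, Submodule.mem_sup] at hy
  obtain ⟨y1, hy1, y2, hy2, rfl⟩ := hy
  obtain ⟨b, rfl⟩ := Finsupp.mem_span_range_iff_exists_finsupp.1 hy1
  obtain ⟨a, rfl⟩ := (Submodule.mem_span_range_iff_exists_fun ℝ).1 hy2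
  refine ⟨a, b, le_of_eq_of_le ?_ hxy.le⟩
  rw [dist_eq_norm, ← Submodule.norm_coe]
  congr 2
  have : ((Finsupp.linearCombination ℝ (fun p : Fin 2 × ℕ+ => vX δ M Δ e p.1 p.2) b :
      X δ M Δ e) : LInf (ℕ+ × ℕ+)) = b.sum fun p c => c • V δ M Δ e p.1 p.2 := by
    rw [Finsupp.linearCombination_apply, Finsupp.sum, Submodule.coe_sum]
    rfl
  rw [← this, Fin.sum_univ_two, add_comm]
  rfl

end Coordinates

/-! ### Existence, completeness and separability -/

theorem exists_isL1Basis : ∃ e : ℕ+ → LInf ℕ+, IsL1Basis e := by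
  obtain ⟨f⟩ : Nonempty (ℕ+ ≃ Finset ℕ+) := ⟨Denumerable.equiv₂ _ _⟩
  have hm : ∀ n : ℕ+, Memℓp (E := fun _ : ℕ+ => ℝ)
      (fun k => if n ∈ f k then (1 : ℝ) else -1) ∞ := by
    intro n
    refine memℓp_infty ⟨1, ?_⟩
    rintro _ ⟨k, rfl⟩
    dsimp only
    split_ifs <;> simp
  -- `e n k` is the sign telling whether `n` belongs to the `k`-th finite set, so that every
  -- pattern of signs on a finite set of indices occurs at some coordinate.
  let e : ℕ+ → LInf ℕ+ := fun n => ⟨_, hm n⟩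
  have he : ∀ n k, e n k = if n ∈ f k then (1 : ℝ) else -1 := fun n k => rfl
  have habs : ∀ n k, |e n k| = 1 := by
    intro n k
    rw [he]
    split_ifs <;> simp
  have hval : ∀ (a : ℕ+ →₀ ℝ) (k : ℕ+),
      (a.sum fun n c => c • e n) k = a.sum fun n c => c * e n k := by
    intro a k
    rw [Finsupp.sum, lp.coeFn_sum, Finset.sum_apply]
    rfl
  have hnorm : ∀ a : ℕ+ →₀ ℝ, ‖a.sum fun n c => c • e n‖ = a.sum fun _ c => |c| := by
    intro a
    apply le_antisymm
    · refine lp.norm_le_of_forall_le (Finset.sum_nonneg fun _ _ => abs_nonneg _) fun k => ?_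
      rw [hval]
      refine (norm_sum_le _ _).trans (Finset.sum_le_sum fun n _ => ?_)
      rw [Real.norm_eq_abs, abs_mul, habs, mul_one]
    · refine le_trans (le_of_eq ?_) ((le_abs_self _).trans
        (lp.norm_apply_le_norm ENNReal.top_ne_zero (a.sum fun n c => c • e n)
          (f.symm (a.support.filter fun n => 0 ≤ a n))))
      rw [hval]
      refine Finset.sum_congr rfl fun n hn => ?_
      dsimp only
      rw [he, f.apply_symm_apply]
      by_cases h0 : 0 ≤ a n
      · rw [if_pos (Finset.mem_filter.2 ⟨hn, h0⟩), abs_of_nonneg h0, mul_one]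
      · have h1 : n ∉ a.support.filter fun n => 0 ≤ a n := by simp [h0]
        rw [if_neg h1, abs_of_neg (not_le.1 h0), mul_neg_one]
  refine ⟨e, fun n => ?_, hnorm⟩
  have := hnorm (Finsupp.single n 1)
  simpa using this

theorem completeSpace_X (δ M Δ : ℝ) (e : ℕ+ → LInf ℕ+) : CompleteSpace (X δ M Δ e) :=
  (Submodule.isClosed_topologicalClosure _).completeSpace_coe

theorem separableSpace_X (δ M Δ : ℝ) (e : ℕ+ → LInf ℕ+) :
    TopologicalSpace.SeparableSpace (X δ M Δ e) :=
  ((((Set.countable_range fun p : Fin 2 × ℕ+ => V δ M Δ e p.1 p.2).union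
    (Set.countable_range (U M Δ e))).isSeparable).span (R := ℝ)).closure.separableSpace

/-! ### Elements that peak at a single coordinate -/

section Peaks

variable {δ M Δ : ℝ} {e : ℕ+ → LInf ℕ+}

/-- The sum `V_{1,n} + V_{2,n}`. In the first row its main part is `2 (v - (2 + 2δ)/3)`, on the
block `n + 1`. -/
def yX (δ M Δ : ℝ) (e : ℕ+ → LInf ℕ+) (n : ℕ+) : X δ M Δ e := vX δ M Δ e 0 n + vX δ M Δ e 1 n

theorem ev_yX (q : ℕ+ × ℕ+) (n : ℕ+) :
    ev q (yX δ M Δ e n) = Vfun δ M Δ e 0 n q + Vfun δ M Δ e 1 n q := rfl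

theorem abs_ev_yX_self_le (h : Admissible δ M Δ) {q n : ℕ+} (hq : blk q = n) :
    |ev (1, q) (yX δ M Δ e n)| ≤ Δ := by
  rw [ev_yX, Vfun_self hq, Vfun_self hq, abs_le]
  have h1 := bump_nonneg h.Delta_pos.le 2 (pos q)
  have h2 := bump_le h.Delta_pos.le 2 (pos q)
  have h3 := bump_nonneg h.Delta_pos.le 3 (pos q)
  have h4 := bump_le h.Delta_pos.le 3 (pos q)
  simp only [Fin.val_zero, Fin.val_one, pow_zero, pow_one, zero_add, one_mul]
  norm_num only
  constructor <;> linarith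

theorem ev_yX_succ {q n : ℕ+} (hq : blk q = n + 1) :
    ev (1, q) (yX δ M Δ e n) = 2 * (vk M (pos q) - (2 + 2 * δ) / 3) := by
  rw [ev_yX, Vfun_succ hq, Vfun_succ hq]
  simp only [Fin.val_zero, Fin.val_one]
  ring

theorem ev_yX_other {q n : ℕ+} (h1 : blk q ≠ n) (h2 : blk q ≠ n + 1) :
    ev (1, q) (yX δ M Δ e n) = 0 := by
  rw [ev_yX]
  by_cases h3 : blk q % 2 = (n : ℕ) % 2
  · rw [Vfun_parity h1 h3, Vfun_parity h1 h3]
    simp only [Fin.val_zero, Fin.val_one]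
    ring
  · rw [Vfun_other h2 h3, Vfun_other h2 h3, add_zero]

theorem abs_ev_yX_le (h : Admissible δ M Δ) (he : IsL1Basis e) {p : ℕ+} (hp : p ≠ 1)
    (q n : ℕ+) : |ev (p, q) (yX δ M Δ e n)| ≤ 1 / 3 + 1 / 10 := by
  rw [ev_yX]
  refine (abs_add_le _ _).trans ?_
  by_cases hp0 : p = idx 0 n
  · have hp1 : p ≠ idx 1 n := by
      rintro rfl
      exact absurd (idx_injective hp0).1 (by decide)
    have h1 := abs_Vfun_le_third h he 0 n hp q
    have h2 := abs_Vfun_le_tenth (δ := δ) (M := M) (Δ := Δ) he hp hp1 q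
    linarith
  · have h1 := abs_Vfun_le_third h he 1 n hp q
    have h2 := abs_Vfun_le_tenth (δ := δ) (M := M) (Δ := Δ) he hp hp0 q
    linarith

/-- An element that peaks in the first row, at place `k` of the block `N + 1`. The multiple of
`U_Q` and the terms with `N'` do not disturb the peak; they are used to bring the element into a
given hyperplane. -/
def peak (δ M Δ : ℝ) (e : ℕ+ → LInf ℕ+) (P Q : Fin 2) (a : ℝ) (N N' : ℕ+) (k : ℕ) : X δ M Δ e :=
  (1 - tk M k) • (uX δ M Δ e P + a • uX δ M Δ e Q) +
    (tk M k / 2) • (yX δ M Δ e N - yX δ M Δ e N')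

theorem ev_peak (q : ℕ+ × ℕ+) (P Q : Fin 2) (a : ℝ) (N N' : ℕ+) (k : ℕ) :
    ev q (peak δ M Δ e P Q a N N' k) =
      (1 - tk M k) * (Ufun M Δ e P q + a * Ufun M Δ e Q q) +
        tk M k / 2 * (ev q (yX δ M Δ e N) - ev q (yX δ M Δ e N')) := by
  simp only [peak, map_add, map_sub, map_smul, smul_eq_mul, ev_uX]

theorem abs_mul_bump_le (hΔ : 0 ≤ Δ) {a : ℝ} (ha : |a| ≤ 1) (i k : ℕ) : |a * bump Δ i k| ≤ Δ := by
  rw [abs_mul, abs_of_nonneg (bump_nonneg hΔ i k)]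
  exact (mul_le_of_le_one_left (bump_nonneg hΔ i k) ha).trans (bump_le hΔ i k)

theorem ev_peak_cell {P Q : Fin 2} {N N' : ℕ+}
    (hP : ((N : ℕ) + 1) % 2 = P) (hQ : (N : ℕ) % 2 = Q) (hN' : (N' : ℕ) % 2 = (N : ℕ) % 2)
    (hne : N' ≠ N) (a : ℝ) {k : ℕ} (hk : k ∈ Finset.Icc 1 8) :
    ev (1, cell (N + 1) k) (peak δ M Δ e P Q a N N' k) =
      (1 - tk M k) * (uk M k + a * bump Δ 8 k) + tk M k * (vk M k - (2 + 2 * δ) / 3) := by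
  have hne' : (N' : ℕ) ≠ N := fun hh => hne (PNat.eq hh)
  have hb := blk_cell (N + 1) hk
  rw [ev_peak, Ufun_eq (by omega), Ufun_ne (by omega), ev_yX_succ hb,
    ev_yX_other (by omega) (by omega), pos_cell _ hk]
  ring

theorem le_peak_value (h : Admissible δ M Δ) {a : ℝ} (ha : |a| ≤ 1) {k : ℕ}
    (hk : k ∈ Finset.Icc 1 8) : (1 - tk M k) + muM M + δ - Δ ≤
      (1 - tk M k) * (uk M k + a * bump Δ 8 k) + tk M k * (vk M k - (2 + 2 * δ) / 3) := by
  have hΔ := h.Delta_pos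
  have ht1 := h.third_lt_tk hk
  have ht2 := h.tk_lt_half hk
  have hgap := h.block_gap hk
  have hu := le_uk h.M_gt hk
  have hv := le_vk h.M_gt hk
  have h1 := (abs_le.1 (abs_mul_bump_le hΔ.le ha 8 k)).1
  have h2 : (1 - tk M k) * (1 - deltaM M - Δ) ≤ (1 - tk M k) * (uk M k + a * bump Δ 8 k) :=
    mul_le_mul_of_nonneg_left (by linarith) (by linarith)
  have h3 : tk M k * (1 - deltaM M - (2 + 2 * δ) / 3) ≤ tk M k * (vk M k - (2 + 2 * δ) / 3) :=
    mul_le_mul_of_nonneg_left (by linarith) (by linarith)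
  have h4 : 0 ≤ tk M k * Δ := mul_nonneg (by linarith) hΔ.le
  linarith

theorem abs_ev_peak_le_of_row_ne (h : Admissible δ M Δ) (he : IsL1Basis e) (P Q : Fin 2)
    (N N' : ℕ+) {a : ℝ} (ha : |a| ≤ 1) {k : ℕ} (hk : k ∈ Finset.Icc 1 8) {p : ℕ+} (hp : p ≠ 1)
    (q : ℕ+) :
    |ev (p, q) (peak δ M Δ e P Q a N N' k)| ≤ (1 - tk M k) + muM M + δ - Δ - Δ := by
  have hΔ := h.Delta_pos
  have hμ := h.Delta_lt_muM
  have hΔδ := h.Delta_lt_delta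
  have hδ := h.delta_lt
  have ht1 := h.third_lt_tk hk
  have ht2 := h.tk_lt_half hk
  rw [ev_peak]
  have h2 : |a * Ufun M Δ e Q (p, q)| ≤ 1 / 10 := by
    rw [abs_mul]
    exact (mul_le_of_le_one_left (abs_nonneg _) ha).trans (abs_Ufun_le he hp q Q)
  have h5 : |Ufun M Δ e P (p, q) + a * Ufun M Δ e Q (p, q)| ≤ 1 / 10 + 1 / 10 :=
    (abs_add_le _ _).trans (add_le_add (abs_Ufun_le he hp q P) h2)
  have h6 : |ev (p, q) (yX δ M Δ e N) - ev (p, q) (yX δ M Δ e N')| ≤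
      1 / 3 + 1 / 10 + (1 / 3 + 1 / 10) :=
    (abs_sub _ _).trans (add_le_add (abs_ev_yX_le h he hp q N) (abs_ev_yX_le h he hp q N'))
  have h7 := mul_le_mul_of_nonneg_left h5 (by linarith : 0 ≤ 1 - tk M k)
  have h8 := mul_le_mul_of_nonneg_left h6 (by linarith : 0 ≤ tk M k / 2)
  refine (abs_add_le _ _).trans ?_
  rw [abs_mul, abs_mul, abs_of_pos (by linarith : 0 < 1 - tk M k),
    abs_of_pos (by linarith : 0 < tk M k / 2)]
  linarith

theorem abs_ev_peak_le_of_parity_ne (h : Admissible δ M Δ) {P Q : Fin 2} {N N' : ℕ+}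
    (hP : ((N : ℕ) + 1) % 2 = P) (hQ : (N : ℕ) % 2 = Q) (hN' : (N' : ℕ) % 2 = (N : ℕ) % 2)
    (hne : N' ≠ N) {a : ℝ} (ha : |a| ≤ 1) {k : ℕ} (hk : k ∈ Finset.Icc 1 8) {q : ℕ+}
    (hq : blk q % 2 ≠ P) :
    |ev (1, q) (peak δ M Δ e P Q a N N' k)| ≤ (1 - tk M k) + muM M + δ - Δ - Δ := by
  have hne' : (N' : ℕ) ≠ N := fun hh => hne (PNat.eq hh)
  have hΔ := h.Delta_pos
  have hμ := h.Delta_lt_muM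
  have hΔδ := h.Delta_lt_delta
  have ht1 := h.third_lt_tk hk
  have ht2 := h.tk_lt_half hk
  have hj := pos_mem q
  rw [ev_peak, Ufun_ne hq, Ufun_eq (by omega : blk q % 2 = Q)]
  have h1 : |a * uk M (pos q)| ≤ 1 := by
    have h1 := uk_le_one h.M_gt hj
    have h2 := le_uk h.M_gt hj
    have h3 := h.deltaM_lt
    have h4 := h.delta_lt
    have h5 : |uk M (pos q)| ≤ 1 := abs_le.2 ⟨by linarith, h1⟩
    rw [abs_mul]
    exact (mul_le_of_le_one_left (abs_nonneg _) ha).trans h5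
  have h4 : |bump Δ 8 (pos q) + a * uk M (pos q)| ≤ Δ + 1 := by
    refine (abs_add_le _ _).trans (add_le_add ?_ h1)
    rw [abs_of_nonneg (bump_nonneg hΔ.le _ _)]
    exact bump_le hΔ.le _ _
  have h5 : |ev (1, q) (yX δ M Δ e N) - ev (1, q) (yX δ M Δ e N')| ≤ Δ := by
    by_cases hbN : blk q = N
    · rw [ev_yX_other (n := N') (by omega) (by omega), sub_zero]
      exact abs_ev_yX_self_le h hbN
    rw [ev_yX_other (n := N) hbN (by omega), zero_sub, abs_neg]
    by_cases hbN' : blk q = N'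
    · exact abs_ev_yX_self_le h hbN'
    · rw [ev_yX_other hbN' (by omega), abs_zero]
      exact hΔ.le
  have h7 := mul_le_mul_of_nonneg_left h4 (by linarith : 0 ≤ 1 - tk M k)
  have h8 := mul_le_mul_of_nonneg_left h5 (by linarith : 0 ≤ tk M k / 2)
  have h9 : 0 ≤ tk M k * Δ := mul_nonneg (by linarith) hΔ.le
  refine (abs_add_le _ _).trans ?_
  rw [abs_mul, abs_mul, abs_of_pos (by linarith : 0 < 1 - tk M k),
    abs_of_pos (by linarith : 0 < tk M k / 2)]
  linarith

/-- At the place `k` of the block `N + 1` the element `peak` exceeds all its other coordinates, in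
absolute value, by at least `Δ`. Among the places of that block this is the strict support of the
parabola, measured by `μ_M`; blocks of the same parity without `v` lose by `block_gap`. -/
theorem abs_ev_peak_le (h : Admissible δ M Δ) (he : IsL1Basis e) {P Q : Fin 2} {N N' : ℕ+}
    (hP : ((N : ℕ) + 1) % 2 = P) (hQ : (N : ℕ) % 2 = Q) (hN' : (N' : ℕ) % 2 = (N : ℕ) % 2)
    (hne : N' ≠ N) {a : ℝ} (ha : |a| ≤ 1) {k : ℕ} (hk : k ∈ Finset.Icc 1 8) {q : ℕ+ × ℕ+}
    (hq : q ≠ (1, cell (N + 1) k)) :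
    |ev q (peak δ M Δ e P Q a N N' k)| ≤
      ev (1, cell (N + 1) k) (peak δ M Δ e P Q a N N' k) - Δ := by
  have hT := le_peak_value h ha hk
  rw [ev_peak_cell hP hQ hN' hne a hk]
  obtain ⟨p, q⟩ := q
  by_cases hp : p = 1
  swap
  · exact (abs_ev_peak_le_of_row_ne h he P Q N N' ha hk hp q).trans (sub_le_sub_right hT Δ)
  subst hp
  by_cases hpar : blk q % 2 = P
  swap
  · exact (abs_ev_peak_le_of_parity_ne h hP hQ hN' hne ha hk hpar).trans
      (sub_le_sub_right hT Δ)
  have hne' : (N' : ℕ) ≠ N := fun hh => hne (PNat.eq hh)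
  have hΔ := h.Delta_pos
  have hμ := h.Delta_lt_muM
  have hΔδ := h.Delta_lt_delta
  have ht1 := h.third_lt_tk hk
  have ht2 := h.tk_lt_half hk
  have hj := pos_mem q
  rw [ev_peak, Ufun_eq hpar, Ufun_ne (by omega : blk q % 2 ≠ Q)]
  by_cases hbN : blk q = N + 1
  · have hjk : pos q ≠ k := fun hjk => hq (by rw [eq_cell hbN hjk])
    rw [ev_yX_succ hbN, ev_yX_other (by omega) (by omega)]
    have hμ' := muM_le hj hk hjk (M := M)
    have hbb : |a * (bump Δ 8 (pos q) - bump Δ 8 k)| ≤ Δ := by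
      have h1 := bump_nonneg hΔ.le 8 (pos q)
      have h2 := bump_le hΔ.le 8 (pos q)
      have h3 := bump_nonneg hΔ.le 8 k
      have h4 := bump_le hΔ.le 8 k
      rw [abs_mul]
      exact (mul_le_of_le_one_left (abs_nonneg _) ha).trans
        (abs_le.2 ⟨by linarith, by linarith⟩)
    have h1 : (1 - tk M k) * (a * (bump Δ 8 (pos q) - bump Δ 8 k)) ≤ (1 - tk M k) * Δ :=
      mul_le_mul_of_nonneg_left (abs_le.1 hbb).2 (by linarith)
    have h2 : 0 ≤ tk M k * Δ := mul_nonneg (by linarith) hΔ.le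
    have hnn := le_uk h.M_gt hj
    have hnv := le_vk h.M_gt hj
    have hdM := h.deltaM_lt
    have hδ := h.delta_lt
    have habj := abs_le.1 (abs_mul_bump_le hΔ.le ha 8 (pos q))
    have hlow : 0 ≤ (1 - tk M k) * (uk M (pos q) + a * bump Δ 8 (pos q)) :=
      mul_nonneg (by linarith) (by linarith)
    have hvj : 0 ≤ tk M k * (vk M (pos q) - (2 + 2 * δ) / 3) :=
      mul_nonneg (by linarith) (by linarith)
    clear hT hdM hδ habj hnn hnv ht1 ht2 hbb hΔδ
    rw [abs_of_nonneg (by linarith only [hlow, hvj])]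
    linarith
  -- On the other blocks of the same parity the second summand is nonpositive and at least `-1/6`.
  have hY' : -(2 / 3) ≤ ev (1, q) (yX δ M Δ e N) - ev (1, q) (yX δ M Δ e N') ∧
      ev (1, q) (yX δ M Δ e N) - ev (1, q) (yX δ M Δ e N') ≤ 0 := by
    rw [ev_yX_other (n := N) (by omega) (by omega)]
    by_cases hbN' : blk q = N' + 1
    · rw [ev_yX_succ hbN']
      have h1 := vk_le_one h.M_gt hj
      have h2 := le_vk h.M_gt hj
      have hdM := h.deltaM_lt
      have hδ := h.delta_lt
      have hδ := h.delta_pos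
      constructor <;> linarith
    · rw [ev_yX_other (by omega) (by omega)]
      norm_num
  have h1 := mul_le_mul_of_nonneg_left hY'.1 (by linarith : 0 ≤ tk M k / 2)
  have h2 := mul_le_mul_of_nonneg_left hY'.2 (by linarith : 0 ≤ tk M k / 2)
  have habj := abs_le.1 (abs_mul_bump_le hΔ.le ha 8 (pos q))
  have hu1 := uk_le_one h.M_gt hj
  have hu2 := le_uk h.M_gt hj
  have hdM := h.deltaM_lt
  have hδ := h.delta_lt
  have hlow : 0 ≤ (1 - tk M k) * (uk M (pos q) + a * bump Δ 8 (pos q)) :=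
    mul_nonneg (by linarith) (by linarith)
  have hup : (1 - tk M k) * (uk M (pos q) + a * bump Δ 8 (pos q)) ≤ (1 - tk M k) * (1 + Δ) :=
    mul_le_mul_of_nonneg_left (by linarith) (by linarith)
  have h3 : 0 ≤ tk M k * Δ := mul_nonneg (by linarith) hΔ.le
  rw [abs_le]
  constructor
  · linarith only [h1, hlow, hT, ht2, hμ, hΔδ, hΔ]
  · linarith only [h2, hup, hT, h3, hμ, hΔδ, hΔ]

set_option maxHeartbeats 1000000 in
/-- The element `2 (1 - t(k)) U_P + t(k) (V_{1,N} + V_{2,N})` keeps its peak, at place `k` of the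
block `N + 1`, when `V_{i,N+1}` is added or subtracted. Here the coefficients of `V_{1,N}` and
`V_{2,N}` add up to less than `1`, the coefficient of `V_{i,N+1}`. -/
theorem abs_ev_moving_le (h : Admissible δ M Δ) (he : IsL1Basis e) {P : Fin 2} {N : ℕ+}
    (hP : ((N : ℕ) + 1) % 2 = P) {τ : ℝ} (hτ : |τ| = 1) (i : Fin 2) {k : ℕ}
    (hk : k ∈ Finset.Icc 1 8) {q : ℕ+ × ℕ+} (hq : q ≠ (1, cell (N + 1) k)) :
    |ev q ((2 * (1 - tk M k)) • uX δ M Δ e P + tk M k • yX δ M Δ e N -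
        τ • vX δ M Δ e i (N + 1))| ≤
      ev (1, cell (N + 1) k) ((2 * (1 - tk M k)) • uX δ M Δ e P + tk M k • yX δ M Δ e N -
        τ • vX δ M Δ e i (N + 1)) - Δ := by
  have hΔ := h.Delta_pos
  have hμ := h.Delta_lt_muM
  have hΔδ := h.Delta_lt_delta
  have hδ := h.delta_lt
  have hdM := h.deltaM_lt
  have hdM0 := deltaM_pos h.M_gt
  have ht1 := h.third_lt_tk hk
  have ht2 := h.tk_lt_half hk
  have hgap := h.block_gap hk
  have hu := le_uk h.M_gt hk
  have hv := le_vk h.M_gt hk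
  have hev : ∀ q, ev q ((2 * (1 - tk M k)) • uX δ M Δ e P + tk M k • yX δ M Δ e N -
      τ • vX δ M Δ e i (N + 1)) = 2 * (1 - tk M k) * Ufun M Δ e P q +
        tk M k * ev q (yX δ M Δ e N) - τ * Vfun δ M Δ e i (N + 1) q := fun q => by
    simp only [map_add, map_sub, map_smul, smul_eq_mul, ev_uX, ev_vX]
  obtain ⟨σ, hσ, hσs⟩ : ∃ σ : ℝ, |σ| = 1 ∧ τ * (-1) ^ (i : ℕ) = σ :=
    ⟨_, by rw [abs_mul, hτ, abs_pow]; simp, rfl⟩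
  have hval : ev (1, cell (N + 1) k) ((2 * (1 - tk M k)) • uX δ M Δ e P +
      tk M k • yX δ M Δ e N - τ • vX δ M Δ e i (N + 1)) =
      2 * (1 - tk M k) * uk M k + 2 * (tk M k * (vk M k - (2 + 2 * δ) / 3)) -
        σ * ((1 - δ) / 3 - bump Δ ((i : ℕ) + 2) k) := by
    have hb := blk_cell (N + 1) hk
    rw [hev, Ufun_eq (by omega), ev_yX_succ hb, Vfun_self (by simpa using hb), pos_cell _ hk,
      ← hσs]
    ring
  have hτV : ∀ q, |τ * Vfun δ M Δ e i (N + 1) q| ≤ 1 / 3 := fun q => by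
    rw [abs_mul, hτ, one_mul, ← ev_vX]
    exact (abs_ev_le _ _).trans (norm_vX_le h he i _)
  have hU : (1 - tk M k) * (1 - deltaM M) ≤ (1 - tk M k) * uk M k :=
    mul_le_mul_of_nonneg_left (by linarith) (by linarith)
  have hV : tk M k * (1 - deltaM M - (2 + 2 * δ) / 3) ≤ tk M k * (vk M k - (2 + 2 * δ) / 3) :=
    mul_le_mul_of_nonneg_left (by linarith) (by linarith)
  have hUV : (1 - tk M k) + tk M k * (1 - 2 * δ) / 3 - deltaM M ≤
      (1 - tk M k) * uk M k + tk M k * (vk M k - (2 + 2 * δ) / 3) := by linarith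
  have htδ : 1 / 3 * (1 - 2 * δ) ≤ tk M k * (1 - 2 * δ) :=
    mul_le_mul_of_nonneg_right ht1.le (by linarith)
  have hσ' : σ = 1 ∨ σ = -1 := (abs_eq zero_le_one).1 hσ
  have hx : |σ * ((1 - δ) / 3 - bump Δ ((i : ℕ) + 2) k)| ≤ 1 / 3 := by
    have h1 := bump_nonneg hΔ.le ((i : ℕ) + 2) k
    have h2 := bump_le hΔ.le ((i : ℕ) + 2) k
    rw [abs_mul, hσ, one_mul, abs_le]
    constructor <;> linarith
  have hx := abs_le.1 hx
  obtain ⟨p, q⟩ := q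
  rw [hval, hev]
  by_cases hp : p = 1
  swap
  · have h1 := abs_Ufun_le (M := M) (Δ := Δ) he hp q P
    have h3 := abs_ev_yX_le h he hp q N
    have h4 := hτV (p, q)
    refine (abs_sub _ _).trans ?_
    refine (add_le_add_left (abs_add_le _ _) _).trans ?_
    rw [abs_mul, abs_mul _ (ev _ _), abs_of_pos (by linarith : 0 < 2 * (1 - tk M k)),
      abs_of_pos (by linarith : 0 < tk M k)]
    have h5 := mul_le_mul_of_nonneg_left h1 (by linarith : 0 ≤ 2 * (1 - tk M k))
    have h6 := mul_le_mul_of_nonneg_left h3 (by linarith : 0 ≤ tk M k)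
    linarith
  subst hp
  have hj := pos_mem q
  have hu1 := uk_le_one h.M_gt hj
  have hu2 := le_uk h.M_gt hj
  have hv2 := le_vk h.M_gt hj
  have hVq := abs_le.1 (hτV (1, q))
  by_cases hpar : blk q % 2 = P
  · rw [Ufun_eq hpar]
    have hlow : (1 - tk M k) * (1 - deltaM M) ≤ (1 - tk M k) * uk M (pos q) :=
      mul_le_mul_of_nonneg_left (by linarith) (by linarith)
    have hup : (1 - tk M k) * uk M (pos q) ≤ (1 - tk M k) * 1 :=
      mul_le_mul_of_nonneg_left (by linarith) (by linarith)
    have hdt : tk M k * deltaM M ≥ 0 := by positivity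
    by_cases hbN : blk q = N + 1
    · have hjk : pos q ≠ k := fun hjk => hq (by rw [eq_cell hbN hjk])
      have hvj : 0 ≤ tk M k * (vk M (pos q) - (2 + 2 * δ) / 3) :=
        mul_nonneg (by linarith) (by linarith)
      have hμ' := muM_le hj hk hjk (M := M)
      rw [ev_yX_succ hbN, abs_of_nonneg (by linarith), Vfun_self (by simpa using hbN),
        ← mul_assoc τ, hσs]
      have h1 := bump_nonneg hΔ.le ((i : ℕ) + 2) k
      have h2 := bump_le hΔ.le ((i : ℕ) + 2) k
      have h3 := bump_nonneg hΔ.le ((i : ℕ) + 2) (pos q)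
      have h4 := bump_le hΔ.le ((i : ℕ) + 2) (pos q)
      rcases hσ' with rfl | rfl <;> linarith
    · rw [ev_yX_other (by omega) hbN, Vfun_parity (by simpa using hbN) (by simp; omega),
        ← mul_assoc τ, hσs]
      have h1 := bump_nonneg hΔ.le ((i : ℕ) + 2) k
      have h2 := bump_le hΔ.le ((i : ℕ) + 2) k
      have h3 := bump_nonneg hΔ.le 6 (pos q)
      have h4 := bump_le hΔ.le 6 (pos q)
      rw [abs_of_nonneg (by rcases hσ' with rfl | rfl <;> linarith)]
      rcases hσ' with rfl | rfl <;> linarith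
  · rw [Ufun_ne hpar]
    have h1 := bump_nonneg hΔ.le 8 (pos q)
    have h2 := bump_le hΔ.le 8 (pos q)
    have h3 : |ev (1, q) (yX δ M Δ e N)| ≤ Δ := by
      by_cases hb : blk q = N
      · exact abs_ev_yX_self_le h hb
      · rw [ev_yX_other hb (by omega), abs_zero]
        exact hΔ.le
    have h5 : 0 ≤ (1 - tk M k) * bump Δ 8 (pos q) := mul_nonneg (by linarith) h1
    have h6 : (1 - tk M k) * bump Δ 8 (pos q) ≤ 1 * Δ :=
      mul_le_mul (by linarith) h2 h1 (by norm_num)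
    have h7 : |tk M k * ev (1, q) (yX δ M Δ e N)| ≤ Δ := by
      rw [abs_mul, abs_of_pos (by linarith : 0 < tk M k)]
      nlinarith [abs_nonneg (ev (1, q) (yX δ M Δ e N))]
    have h7 := abs_le.1 h7
    rw [abs_le]
    constructor <;> linarith

end Peaks

/-! ### The norm of the lower rows -/

section Rows

variable {δ M Δ : ℝ} {e : ℕ+ → LInf ℕ+}

/-- The map `(i, n) ↦ 2 n + i - 1`, which numbers the generators `V_{i,n}` by `2, 3, …`. -/
def idxEmb : Fin 2 × ℕ+ ↪ ℕ+ where
  toFun p := idx p.1 p.2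
  inj' _ _ hp := Prod.ext (idx_injective hp).1 (idx_injective hp).2

theorem Vfun_row_idx (N : ℕ+) (p : Fin 2 × ℕ+) (q : ℕ+) :
    Vfun δ M Δ e p.1 p.2 (idx 0 (N + 1), q) =
      (if p = (0, N + 1) then (1 - δ) / 3 * e 1 q else 0) +
        (if p = (0, N + 1) ∨ p.2 = N then 0 else 1 / 10 * e (idx p.1 p.2) q) := by
  obtain ⟨i, n⟩ := p
  simp only [Vfun, idx_ne_one, if_false]
  by_cases h1 : idx 0 (N + 1) = idx i n
  · obtain ⟨rfl, rfl⟩ := idx_injective h1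
    simp
  · have h1' : ¬ ((i, n) = ((0 : Fin 2), N + 1)) := by
      rintro h
      obtain ⟨rfl, rfl⟩ := Prod.mk.inj h
      exact h1 rfl
    rw [if_neg h1, if_neg h1', zero_add]
    by_cases h2 : n = N
    · subst h2
      rw [if_pos, if_pos (Or.inr rfl)]
      left
      exact PNat.eq rfl
    · rw [if_neg, if_neg (by simp [h1', h2])]
      have h2' : (n : ℕ) ≠ N := fun hh => h2 (PNat.eq hh)
      rintro (h | h)
      · have : 2 * ((N : ℕ) + 1) + 0 = 2 * (n + 1) := congrArg PNat.val h
        omega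
      · have : 2 * ((N : ℕ) + 1) + 0 = 2 * (n + 1) + 1 := congrArg PNat.val h
        omega

/-- The norm of a combination of generators is at least the `ℓ₁`-type norm of its row
`2 (N + 1)`. -/
theorem row_le_norm_comb (he : IsL1Basis e) (N : ℕ+) (a : Fin 2 → ℝ) (b : Fin 2 × ℕ+ →₀ ℝ) :
    |(a 0 + a 1) / 10 + (1 - δ) / 3 * b (0, N + 1)| +
        (b.sum fun p c => if p = (0, N + 1) ∨ p.2 = N then 0 else |c| / 10) ≤
      ‖comb δ M Δ e a b‖ := by
  set A := (a 0 + a 1) / 10 + (1 - δ) / 3 * b (0, N + 1) with hA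
  let b' : Fin 2 × ℕ+ →₀ ℝ := b.filter fun p => ¬ (p = (0, N + 1) ∨ p.2 = N)
  have hb' : ∀ F : Fin 2 × ℕ+ → ℝ → ℝ, b'.sum F =
      b.sum fun p c => if p = (0, N + 1) ∨ p.2 = N then 0 else F p c := fun F => by
    rw [Finsupp.sum_filter_index, Finsupp.support_filter, Finset.sum_filter]
    refine Finset.sum_congr rfl fun p _ => ?_
    dsimp only
    by_cases hp : p = (0, N + 1) ∨ p.2 = N
    · rw [if_neg (not_not.2 hp), if_pos hp]
    · rw [if_pos hp, if_neg hp]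
  let g : ℕ+ →₀ ℝ := Finsupp.single 1 A + ((1 / 10 : ℝ) • b').embDomain idxEmb
  have hg : ∀ F : ℕ+ → ℝ → ℝ, (∀ n, F n 0 = 0) →
      g.sum F = F 1 A + b'.sum fun p c => F (idx p.1 p.2) (1 / 10 * c) := fun F hF => by
    rw [Finsupp.sum_add_index_of_disjoint, Finsupp.sum_single_index (hF 1),
      Finsupp.sum_embDomain, Finsupp.sum_smul_index fun _ => hF _]
    · rfl
    · rw [Finset.disjoint_left]
      intro n hn hn'
      rw [Finsupp.support_embDomain, Finset.mem_map] at hn'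
      obtain ⟨p, -, rfl⟩ := hn'
      have := Finsupp.support_single_subset hn
      exact idx_ne_one p.1 p.2 (Finset.mem_singleton.1 this)
  have h1 : ‖g.sum fun n c => c • e n‖ ≤ ‖comb δ M Δ e a b‖ := by
    refine lp.norm_le_of_forall_le (norm_nonneg _) fun q => ?_
    have h2 := abs_ev_le (idx 0 (N + 1), q) (comb δ M Δ e a b)
    refine le_of_eq_of_le ?_ h2
    rw [Real.norm_eq_abs]
    congr 1
    have h3 : (g.sum fun n c => c • e n) q = g.sum fun n c => c * e n q := by
      rw [Finsupp.sum, lp.coeFn_sum, Finset.sum_apply]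
      rfl
    rw [h3, hg (fun n c => c * e n q) (fun n => zero_mul _), hb', ev_comb]
    simp only [Vfun_row_idx, mul_add, Finsupp.sum_add]
    have h4 : (b.sum fun p c => c * if p = ((0 : Fin 2), N + 1) then (1 - δ) / 3 * e 1 q else 0) =
        b (0, N + 1) * ((1 - δ) / 3 * e 1 q) := by
      simp only [mul_ite, mul_zero]
      rw [Finsupp.sum_ite_eq']
      split_ifs with h5
      · rfl
      · rw [Finsupp.notMem_support_iff.1 h5, zero_mul]
    have h5 : (b.sum fun p c => c * if p = ((0 : Fin 2), N + 1) ∨ p.2 = N then 0 else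
        1 / 10 * e (idx p.1 p.2) q) = b.sum fun p c =>
        if p = ((0 : Fin 2), N + 1) ∨ p.2 = N then 0 else 1 / 10 * c * e (idx p.1 p.2) q := by
      refine Finsupp.sum_congr fun p _ => ?_
      split_ifs <;> ring
    rw [h4, h5, hA]
    simp only [Ufun, idx_ne_one, if_false]
    ring
  rw [he.2, hg _ (fun _ => abs_zero), hb'] at h1
  refine le_of_eq_of_le ?_ h1
  congr 1
  refine Finsupp.sum_congr fun p _ => ?_
  split_ifs
  · rfl
  · rw [abs_mul, abs_of_pos (by norm_num : (0 : ℝ) < 1 / 10)]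
    ring

/-- The `ℓ₁`-norm of the coefficients at the generators `V_{i,n}`, without `V_{1,N+1}`,
`V_{1,N'+1}`, `V_{1,N}` and `V_{2,N}`. -/
def restSum (N N' : ℕ+) (b : Fin 2 × ℕ+ →₀ ℝ) : ℝ :=
  b.sum fun p c => if p = (0, N + 1) ∨ p = (0, N' + 1) ∨ p.2 = N then 0 else |c|

/-- The increment of the norm of row `2 (N + 1)` when a combination with coefficients `a` and `b`
is added to a large multiple of `V_{1,N+1} - V_{1,N'+1}`. -/
def rowGain (δ : ℝ) (N N' : ℕ+) (a : Fin 2 → ℝ) (b : Fin 2 × ℕ+ →₀ ℝ) : ℝ :=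
  (a 0 + a 1) / 10 + (1 - δ) / 3 * b (0, N + 1) - b (0, N' + 1) / 10 + restSum N N' b / 10

theorem restSum_eq_sum (N N' : ℕ+) (b : Fin 2 × ℕ+ →₀ ℝ) {s : Finset (Fin 2 × ℕ+)}
    (hs : b.support ⊆ s) : restSum N N' b =
      ∑ p ∈ s, if p = (0, N + 1) ∨ p = (0, N' + 1) ∨ p.2 = N then 0 else |b p| :=
  Finsupp.sum_of_support_subset _ hs _ fun p _ => by simp

theorem rowGain_le_norm (he : IsL1Basis e) {N N' : ℕ+} (hne : N' ≠ N) (hne' : N' + 1 ≠ N)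
    {S : ℝ} (a : Fin 2 → ℝ) (b : Fin 2 × ℕ+ →₀ ℝ) :
    S * ((1 - δ) / 3 + 1 / 10) + rowGain δ N N' a b ≤
      ‖comb δ M Δ e a b + S • (vX δ M Δ e 0 (N + 1) - vX δ M Δ e 0 (N' + 1))‖ := by
  have hN : ((0 : Fin 2), N' + 1) ≠ (0, N + 1) := fun hh =>
    hne (add_right_cancel (Prod.mk.inj hh).2)
  set b' : Fin 2 × ℕ+ →₀ ℝ :=
    b + (Finsupp.single (0, N + 1) S - Finsupp.single (0, N' + 1) S) with hb'
  have hcomb : comb δ M Δ e a b + S • (vX δ M Δ e 0 (N + 1) - vX δ M Δ e 0 (N' + 1)) =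
      comb δ M Δ e a b' := by
    rw [hb', comb, comb, map_add, map_sub, Finsupp.linearCombination_single,
      Finsupp.linearCombination_single, smul_sub, ← add_assoc]
  have h0 : b' (0, N + 1) = b (0, N + 1) + S := by
    simp [hb', hN]
  have h1 : b' (0, N' + 1) = b (0, N' + 1) - S := by
    simp [hb', hN.symm]
    ring
  have h2 : ∀ p, p ≠ (0, N + 1) → p ≠ (0, N' + 1) → b' p = b p := fun p hp hp' => by
    simp [hb', hp.symm, hp'.symm]
  rw [hcomb]
  refine le_trans ?_ (row_le_norm_comb he N a b')
  classical
  let s := insert ((0 : Fin 2), N' + 1) (b.support ∪ b'.support)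
  have hs : b.support ⊆ s :=
    Finset.subset_union_left.trans (Finset.subset_insert _ _)
  have hs' : b'.support ⊆ s :=
    Finset.subset_union_right.trans (Finset.subset_insert _ _)
  have h3 : (b'.sum fun p c => if p = (0, N + 1) ∨ p.2 = N then 0 else |c| / 10) =
      |b (0, N' + 1) - S| / 10 + restSum N N' b / 10 := by
    rw [Finsupp.sum_of_support_subset _ hs' _ (fun p _ => by simp), restSum_eq_sum N N' b hs,
      Finset.sum_div, ← Finset.add_sum_erase s _ (Finset.mem_insert_self (0, N' + 1) _),
      ← Finset.add_sum_erase s (fun p => (if p = (0, N + 1) ∨ p = (0, N' + 1) ∨ p.2 = N then 0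
        else |b p|) / 10) (Finset.mem_insert_self (0, N' + 1) _)]
    rw [if_neg (by simp [hne, hne']), h1, if_pos (Or.inr (Or.inl rfl)), zero_div, zero_add]
    congr 1
    refine Finset.sum_congr rfl fun p hp => ?_
    have hp' := Finset.ne_of_mem_erase hp
    by_cases hp0 : p = (0, N + 1)
    · simp [hp0]
    · simp only [hp0, hp', false_or]
      rw [h2 p hp0 hp']
      split_ifs <;> simp
  rw [h3, h0, rowGain]
  have h4 := le_abs_self ((a 0 + a 1) / 10 + (1 - δ) / 3 * (b (0, N + 1) + S))
  have h5 := neg_le_abs (b (0, N' + 1) - S)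
  linarith

theorem Vfun_zero_nonneg_of_parity (h : Admissible δ M Δ) {n q : ℕ+}
    (hq : blk q % 2 = (n : ℕ) % 2) : 0 ≤ Vfun δ M Δ e 0 n (1, q) := by
  have h1 := h.Delta_lt_delta
  have h2 := h.delta_lt
  by_cases hb : blk q = n
  · have := bump_le h.Delta_pos.le 2 (pos q)
    rw [Vfun_self hb]
    simp only [Fin.val_zero, pow_zero, one_mul, zero_add]
    linarith
  · have := bump_le h.Delta_pos.le 6 (pos q)
    rw [Vfun_parity hb hq]
    simp only [Fin.val_zero, pow_zero, one_mul]
    linarith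

theorem abs_ev_rowPeak_le (h : Admissible δ M Δ) {N N' : ℕ+} (hne : N' ≠ N)
    (hN' : (N' : ℕ) % 2 = (N : ℕ) % 2) (q : ℕ+) :
    |ev (1, q) (vX δ M Δ e 0 (N + 1) - vX δ M Δ e 0 (N' + 1))| ≤ 1 / 3 := by
  have hne' : (N' : ℕ) ≠ N := fun hh => hne (PNat.eq hh)
  have hb : ∀ n : ℕ+, |Vfun δ M Δ e 0 n (1, q)| ≤ 1 / 3 := fun n => abs_Vfun_row_one_le h 0 n q
  rw [map_sub, ev_vX, ev_vX]
  by_cases hp : blk q % 2 = ((N : ℕ) + 1) % 2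
  · have h1 := Vfun_zero_nonneg_of_parity (e := e) h (n := N + 1) (q := q) (by simpa using hp)
    have h2 := Vfun_zero_nonneg_of_parity (e := e) h (n := N' + 1) (q := q)
      (by rw [hp]; simp only [PNat.add_coe, PNat.val_ofNat]; omega)
    have h3 := abs_le.1 (hb (N + 1))
    have h4 := abs_le.1 (hb (N' + 1))
    rw [abs_le]
    constructor <;> linarith
  · by_cases hbN : blk q = N + 1 + 1
    · rw [Vfun_other (n := N' + 1) (by simp only [PNat.add_coe, PNat.val_ofNat]; omega)
        (by simp only [PNat.add_coe, PNat.val_ofNat]; omega), sub_zero]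
      exact hb _
    · rw [Vfun_other (n := N + 1) (by simpa using hbN) (by simpa using hp), zero_sub, abs_neg]
      exact hb _

theorem norm_add_rowPeak_le (h : Admissible δ M Δ) (he : IsL1Basis e) {N N' : ℕ+} (hne : N' ≠ N)
    (hN' : (N' : ℕ) % 2 = (N : ℕ) % 2) {x : X δ M Δ e} {S ψ : ℝ} (hS : 0 ≤ S) (hψ : 0 ≤ ψ)
    (hx : ‖x‖ ≤ S / 20) (h1 : ∀ q, |ev (idx 0 (N + 1), q) x| ≤ ψ)
    (h2 : ∀ q, |ev (idx 0 (N' + 1), q) x| ≤ ψ) :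
    ‖x + S • (vX δ M Δ e 0 (N + 1) - vX δ M Δ e 0 (N' + 1))‖ ≤
      S * ((1 - δ) / 3 + 1 / 10) + ψ := by
  have hδ := h.delta_lt
  have hSδ : S * δ ≤ S * (1 / 10) := mul_le_mul_of_nonneg_left hδ.le hS
  refine norm_le_of_abs_ev_le fun ⟨p, q⟩ => ?_
  rw [map_add, map_smul, smul_eq_mul]
  refine (abs_add_le _ _).trans ?_
  rw [abs_mul, abs_of_nonneg hS]
  have hxq := (abs_ev_le (p, q) x).trans hx
  by_cases hp : p = 1
  · subst hp
    have := mul_le_mul_of_nonneg_left (abs_ev_rowPeak_le (e := e) h hne hN' q) hS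
    linarith
  rw [map_sub, ev_vX, ev_vX]
  have h3 := abs_sub (Vfun δ M Δ e 0 (N + 1) (p, q)) (Vfun δ M Δ e 0 (N' + 1) (p, q))
  by_cases hp1 : p = idx 0 (N + 1)
  · have hp2 : p ≠ idx 0 (N' + 1) := fun hp2 => by
      have := (idx_injective (hp2.symm.trans hp1)).2
      exact hne (add_right_cancel this)
    have h4 := abs_Vfun_le_tenth (δ := δ) (M := M) (Δ := Δ) he hp hp2 q
    subst hp1
    have h5 := abs_Vfun_idx_le h he 0 (N + 1) q
    have h6 := mul_le_mul_of_nonneg_left (h3.trans (add_le_add h5 h4)) hS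
    linarith [h1 q]
  have h4 := abs_Vfun_le_tenth (δ := δ) (M := M) (Δ := Δ) he hp hp1 q
  by_cases hp2 : p = idx 0 (N' + 1)
  · subst hp2
    have h5 := abs_Vfun_idx_le h he 0 (N' + 1) q
    have h6 := mul_le_mul_of_nonneg_left (h3.trans (add_le_add h4 h5)) hS
    linarith [h2 q]
  · have h5 := abs_Vfun_le_tenth (δ := δ) (M := M) (Δ := Δ) he hp hp2 q
    have h6 := mul_le_mul_of_nonneg_left (h3.trans (add_le_add h4 h5)) hS
    linarith

end Rows

/-! ### The first row on one block determines the coefficients near that block -/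

section Blocks

variable {δ M Δ : ℝ} {e : ℕ+ → LInf ℕ+}

/-- The values at the eight places of the block `N + 1` as a function of the seven coefficients that
matter there: `c 0` at `U_P` and `c 1` at `U_Q`, the alternating sum `c 2` of the coefficients at
the other `V_{i,n}` of the same parity, `c 3` and `c 4` at `V_{1,N+1}` and `V_{2,N+1}`, and the sum
`c 5` and the difference `c 6` of those at `V_{1,N}` and `V_{2,N}`. -/
def blockMap (δ M Δ : ℝ) : (Fin 7 → ℝ) →ₗ[ℝ] (Fin 8 → ℝ) where
  toFun c j := c 0 * uk M (j + 1) + c 1 * bump Δ 8 (j + 1) +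
    c 2 * ((1 - 2 * δ) / 3 - bump Δ 6 (j + 1)) + c 3 * ((1 - δ) / 3 - bump Δ 2 (j + 1)) -
    c 4 * ((1 - δ) / 3 - bump Δ 3 (j + 1)) + c 5 * (vk M (j + 1) - (2 + 2 * δ) / 3) +
    c 6 * bump Δ 7 (j + 1)
  map_add' c c' := by
    ext j
    simp only [Pi.add_apply]
    ring
  map_smul' r c := by
    ext j
    simp only [Pi.smul_apply, smul_eq_mul, RingHom.id_apply]
    ring

theorem eq_zero_of_three_roots {A B C x y z : ℝ} (hxy : x < y) (hyz : y < z)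
    (hx : A + B * x + C * x ^ 2 = 0) (hy : A + B * y + C * y ^ 2 = 0)
    (hz : A + B * z + C * z ^ 2 = 0) : A = 0 ∧ B = 0 ∧ C = 0 := by
  have h1 : B + C * (x + y) = 0 := by
    have : (y - x) * (B + C * (x + y)) = 0 := by linear_combination hy - hx
    exact (mul_eq_zero.1 this).resolve_left (by linarith)
  have h2 : B + C * (y + z) = 0 := by
    have : (z - y) * (B + C * (y + z)) = 0 := by linear_combination hz - hy
    exact (mul_eq_zero.1 this).resolve_left (by linarith)
  have hC : C = 0 := by
    have : (z - x) * C = 0 := by linear_combination h2 - h1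
    exact (mul_eq_zero.1 this).resolve_left (by linarith)
  subst hC
  have hB : B = 0 := by linarith
  subst hB
  exact ⟨by linarith, rfl, rfl⟩

/-- No bump sits at the places `1, 4, 5`, where `1, x, x²` are independent; each of the other five
places carries the bump of a single coefficient. -/
theorem blockMap_ker (h : Admissible δ M Δ) : (blockMap δ M Δ).ker = ⊥ := by
  rw [LinearMap.ker_eq_bot']
  intro c hc
  have hΔ := h.Delta_pos.ne'
  have hj : ∀ j : Fin 8, blockMap δ M Δ c j = 0 := fun j => by rw [hc]; rfl
  have h1 := hj 0
  have h2 := hj 1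
  have h3 := hj 2
  have h4 := hj 3
  have h5 := hj 4
  have h6 := hj 5
  have h7 := hj 6
  have h8 := hj 7
  simp [blockMap, bump, uk, vk] at h1 h2 h3 h4 h5 h6 h7 h8
  obtain ⟨hA, hB, hC⟩ := eq_zero_of_three_roots
    (A := c 0 * alpha M + c 2 * ((1 - 2 * δ) / 3) + c 3 * ((1 - δ) / 3) - c 4 * ((1 - δ) / 3) +
      c 5 * (beta M - (2 + 2 * δ) / 3)) (B := c 0) (C := - c 5)
    (xk_lt_xk h.M_gt (show 1 < 4 by norm_num) (by norm_num))
    (xk_lt_xk h.M_gt (show 4 < 5 by norm_num) (by norm_num))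
    (by linear_combination h1) (by linear_combination h4) (by linear_combination h5)
  have hC : c 5 = 0 := by linarith
  rw [hB, hC] at hA h2 h3 h6 h7 h8
  have e1 : c 1 = 0 :=
    (mul_eq_zero.1 (by linear_combination h8 - hA : c 1 * Δ = 0)).resolve_right hΔ
  have e2 : c 2 = 0 :=
    (mul_eq_zero.1 (by linear_combination hA - h6 : c 2 * Δ = 0)).resolve_right hΔ
  have e3 : c 3 = 0 :=
    (mul_eq_zero.1 (by linear_combination hA - h2 : c 3 * Δ = 0)).resolve_right hΔ
  have e4 : c 4 = 0 :=
    (mul_eq_zero.1 (by linear_combination h3 - hA : c 4 * Δ = 0)).resolve_right hΔ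
  have e6 : c 6 = 0 :=
    (mul_eq_zero.1 (by linear_combination h7 - hA : c 6 * Δ = 0)).resolve_right hΔ
  ext j
  fin_cases j <;> simp [hB, e1, e2, e3, e4, hC, e6]

theorem Vfun_block (N : ℕ+) {q : ℕ+} (hq : blk q = N + 1) (p : Fin 2 × ℕ+) :
    Vfun δ M Δ e p.1 p.2 (1, q) =
      (if p.2 ≠ N + 1 ∧ (p.2 : ℕ) % 2 = ((N : ℕ) + 1) % 2 then (-1) ^ (p.1 : ℕ) else 0) *
          ((1 - 2 * δ) / 3 - bump Δ 6 (pos q)) +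
        (if p = (0, N + 1) then (1 - δ) / 3 - bump Δ 2 (pos q) else 0) +
        (if p = (1, N + 1) then -((1 - δ) / 3 - bump Δ 3 (pos q)) else 0) +
        (if p = (0, N) then vk M (pos q) - (2 + 2 * δ) / 3 - bump Δ 7 (pos q) else 0) +
        (if p = (1, N) then vk M (pos q) - (2 + 2 * δ) / 3 + bump Δ 7 (pos q) else 0) := by
  obtain ⟨i, n⟩ := p
  dsimp only
  have hNN : N ≠ N + 1 := fun hh => by
    have : (N : ℕ) = N + 1 := congrArg PNat.val hh
    omega
  by_cases h1 : n = N + 1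
  · subst h1
    rw [Vfun_self (by simpa using hq)]
    fin_cases i <;> simp [hNN.symm]
  by_cases h2 : n = N
  · subst h2
    have h3 : ¬ ((n : ℕ) % 2 = ((n : ℕ) + 1) % 2) := by omega
    rw [Vfun_succ hq]
    fin_cases i <;> simp [hNN, h3]
    ring
  have h1' : (n : ℕ) ≠ N + 1 := fun hh => h1 (PNat.eq (by simpa using hh))
  have h2' : (n : ℕ) ≠ N := fun hh => h2 (PNat.eq hh)
  by_cases h3 : (n : ℕ) % 2 = ((N : ℕ) + 1) % 2
  · rw [Vfun_parity (by omega) (by omega)]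
    simp [h1, h2, h3]
  · rw [Vfun_other (by omega) (by omega)]
    simp [h1, h2, h3]

theorem finsuppSum_mul_ite (b : Fin 2 × ℕ+ →₀ ℝ) (p0 : Fin 2 × ℕ+) (c : ℝ) :
    (b.sum fun p r => r * if p = p0 then c else 0) = b p0 * c := by
  simp only [mul_ite, mul_zero]
  rw [Finsupp.sum_ite_eq']
  split_ifs with h5
  · rfl
  · rw [Finsupp.notMem_support_iff.1 h5, zero_mul]

/-- A combination of generators that is small at the eight places of the block `N + 1` has small
coefficients at `U_1`, `U_2` and at the `V_{i,N}` and `V_{i,N+1}`. -/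
theorem exists_coeff_bound (h : Admissible δ M Δ) (e : ℕ+ → LInf ℕ+) :
    ∃ C : ℝ, 0 < C ∧ ∀ (N : ℕ+) (a : Fin 2 → ℝ) (b : Fin 2 × ℕ+ →₀ ℝ) (ε : ℝ),
      (∀ k ∈ Finset.Icc 1 8, |ev (1, cell (N + 1) k) (comb δ M Δ e a b)| ≤ ε) →
      (∀ i, |a i| ≤ C * ε) ∧ ∀ i, |b (i, N + 1)| ≤ C * ε ∧ |b (i, N)| ≤ C * ε := by
  obtain ⟨C, hC, hanti⟩ := (blockMap δ M Δ).exists_antilipschitzWith (blockMap_ker h)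
  refine ⟨C, hC, fun N a b ε hε => ?_⟩
  have key : ∀ P Q : Fin 2, ((N : ℕ) + 1) % 2 = P → (N : ℕ) % 2 = Q →
      |a P| ≤ C * ε ∧ |a Q| ≤ C * ε ∧
      ∀ i, |b (i, N + 1)| ≤ C * ε ∧ |b (i, N)| ≤ C * ε := by
    intro P Q hP hQ
    let s : ℝ := b.sum fun p c =>
      c * if p.2 ≠ N + 1 ∧ (p.2 : ℕ) % 2 = ((N : ℕ) + 1) % 2 then (-1) ^ (p.1 : ℕ) else 0
    let c : Fin 7 → ℝ := ![a P, a Q, s, b (0, N + 1), b (1, N + 1), b (0, N) + b (1, N),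
      b (1, N) - b (0, N)]
    have hval : ∀ j : Fin 8, blockMap δ M Δ c j =
        ev (1, cell (N + 1) (j + 1)) (comb δ M Δ e a b) := by
      intro j
      have hk : (j : ℕ) + 1 ∈ Finset.Icc 1 8 := by
        rw [Finset.mem_Icc]
        omega
      have hb := blk_cell (N + 1) hk
      have hU : a 0 * Ufun M Δ e 0 (1, cell (N + 1) (j + 1)) +
          a 1 * Ufun M Δ e 1 (1, cell (N + 1) (j + 1)) =
          a P * uk M (j + 1) + a Q * bump Δ 8 (j + 1) := by
        have hUP : Ufun M Δ e P (1, cell (N + 1) (j + 1)) = uk M (j + 1) := by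
          rw [Ufun_eq (by omega), pos_cell _ hk]
        have hUQ : Ufun M Δ e Q (1, cell (N + 1) (j + 1)) = bump Δ 8 (j + 1) := by
          rw [Ufun_ne (by omega), pos_cell _ hk]
        rw [← hUP, ← hUQ]
        have hPQ : P = 0 ∧ Q = 1 ∨ P = 1 ∧ Q = 0 := by
          rcases Nat.mod_two_eq_zero_or_one N with h0 | h0
          · exact Or.inr ⟨Fin.ext (by simp; omega), Fin.ext (by simp; omega)⟩
          · exact Or.inl ⟨Fin.ext (by simp; omega), Fin.ext (by simp; omega)⟩
        rcases hPQ with ⟨rfl, rfl⟩ | ⟨rfl, rfl⟩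
        · rfl
        · exact add_comm _ _
      rw [ev_comb, hU]
      simp only [Vfun_block N hb, mul_add, Finsupp.sum_add, finsuppSum_mul_ite, pos_cell _ hk]
      have hs : (b.sum fun p c => c * ((if p.2 ≠ N + 1 ∧ (p.2 : ℕ) % 2 = ((N : ℕ) + 1) % 2 then
          (-1) ^ (p.1 : ℕ) else 0) * ((1 - 2 * δ) / 3 - bump Δ 6 (j + 1)))) =
          s * ((1 - 2 * δ) / 3 - bump Δ 6 (j + 1)) := by
        rw [Finsupp.sum_mul]
        refine Finsupp.sum_congr fun p _ => ?_
        ring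
      rw [hs]
      change a P * uk M (j + 1) + a Q * bump Δ 8 (j + 1) + s * ((1 - 2 * δ) / 3 -
        bump Δ 6 (j + 1)) + b (0, N + 1) * ((1 - δ) / 3 - bump Δ 2 (j + 1)) -
        b (1, N + 1) * ((1 - δ) / 3 - bump Δ 3 (j + 1)) + (b (0, N) + b (1, N)) *
        (vk M (j + 1) - (2 + 2 * δ) / 3) + (b (1, N) - b (0, N)) * bump Δ 7 (j + 1) = _
      ring
    have hε0 : 0 ≤ ε := (abs_nonneg _).trans (hε 1 (by decide))
    have hnorm : ‖blockMap δ M Δ c‖ ≤ ε := by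
      rw [pi_norm_le_iff_of_nonneg hε0]
      intro j
      rw [hval]
      exact hε _ (by rw [Finset.mem_Icc]; omega)
    have hc : ‖c‖ ≤ C * ε := by
      have := hanti.le_mul_dist c 0
      rw [map_zero, dist_zero_right, dist_zero_right] at this
      exact this.trans (mul_le_mul_of_nonneg_left hnorm C.2)
    have hci : ∀ i, |c i| ≤ C * ε := fun i => (norm_le_pi_norm c i).trans hc
    have c5 : |b (0, N) + b (1, N)| ≤ C * ε := hci 5
    have c6 : |b (1, N) - b (0, N)| ≤ C * ε := hci 6
    have c5 := abs_le.1 c5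
    have c6 := abs_le.1 c6
    refine ⟨hci 0, hci 1, fun i => ?_⟩
    fin_cases i
    · exact ⟨hci 3, abs_le.2 ⟨by simp; linarith, by simp; linarith⟩⟩
    · exact ⟨hci 4, abs_le.2 ⟨by simp; linarith, by simp; linarith⟩⟩
  rcases Nat.mod_two_eq_zero_or_one N with h0 | h0
  · obtain ⟨k1, k2, k3⟩ := key 1 0 (by simp; omega) (by simp; omega)
    refine ⟨fun i => ?_, k3⟩
    fin_cases i <;> assumption
  · obtain ⟨k1, k2, k3⟩ := key 0 1 (by simp; omega) (by simp; omega)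
    refine ⟨fun i => ?_, k3⟩
    fin_cases i <;> assumption

theorem restSum_sub_single_le (N N' : ℕ+) (b : Fin 2 × ℕ+ →₀ ℝ) (p₀ : Fin 2 × ℕ+) (θ : ℝ) :
    restSum N N' (b - Finsupp.single p₀ θ) + restSum N N' (Finsupp.single p₀ θ) ≤
      restSum N N' b + 2 * |(b - Finsupp.single p₀ θ) p₀| := by
  classical
  set b₀ : Fin 2 × ℕ+ →₀ ℝ := Finsupp.single p₀ θ with hb₀
  let s := insert p₀ (b.support ∪ (b₀.support ∪ (b - b₀).support))
  have hs1 : b.support ⊆ s := Finset.subset_union_left.trans (Finset.subset_insert _ _)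
  have hs2 : b₀.support ⊆ s :=
    (Finset.subset_union_left.trans Finset.subset_union_right).trans (Finset.subset_insert _ _)
  have hs3 : (b - b₀).support ⊆ s :=
    (Finset.subset_union_right.trans Finset.subset_union_right).trans (Finset.subset_insert _ _)
  have hp0 : p₀ ∈ s := Finset.mem_insert_self _ _
  rw [restSum_eq_sum N N' _ hs1, restSum_eq_sum N N' _ hs2, restSum_eq_sum N N' _ hs3,
    ← Finset.sum_add_distrib]
  have hpick : |(b - b₀) p₀| = ∑ p ∈ s, if p = p₀ then |(b - b₀) p| else 0 := by
    rw [Finset.sum_ite_eq', if_pos hp0]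
  rw [hpick, Finset.mul_sum, ← Finset.sum_add_distrib]
  refine Finset.sum_le_sum fun p _ => ?_
  have h3 := abs_nonneg ((b - b₀) p)
  by_cases hp : p = p₀
  · rw [if_pos hp]
    have h2 : |b₀ p| ≤ |b p| + |(b - b₀) p| := by
      have h3 := abs_sub (b p) ((b - b₀) p)
      rwa [Finsupp.sub_apply, sub_sub_cancel, ← Finsupp.sub_apply] at h3
    split_ifs <;> linarith
  · have h2 : b₀ p = 0 := by
      rw [hb₀, Finsupp.single_apply, if_neg fun hh => hp hh.symm]
    rw [if_neg hp, Finsupp.sub_apply, h2, sub_zero, abs_zero, mul_zero, add_zero]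
    split_ifs <;> simp

theorem sum_abs_le_restSum (N N' : ℕ+) (b : Fin 2 × ℕ+ →₀ ℝ) :
    (b.sum fun _ c => |c|) ≤ |b (0, N + 1)| + |b (0, N' + 1)| + |b (0, N)| + |b (1, N)| +
      restSum N N' b := by
  classical
  let s := insert ((0 : Fin 2), N + 1) (insert ((0 : Fin 2), N' + 1) (insert ((0 : Fin 2), N)
    (insert ((1 : Fin 2), N) b.support)))
  have hs : b.support ⊆ s := fun p hp => by
    simp only [s, Finset.mem_insert]
    tauto
  rw [Finsupp.sum_of_support_subset _ hs _ (fun _ _ => abs_zero), restSum_eq_sum N N' _ hs]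
  have hpick : ∀ p0 ∈ s, |b p0| = ∑ p ∈ s, if p = p0 then |b p| else 0 :=
    fun p0 hp0 => by rw [Finset.sum_ite_eq', if_pos hp0]
  rw [hpick (0, N + 1) (by simp [s]), hpick (0, N' + 1) (by simp [s]),
    hpick (0, N) (by simp [s]), hpick (1, N) (by simp [s]), ← Finset.sum_add_distrib,
    ← Finset.sum_add_distrib, ← Finset.sum_add_distrib, ← Finset.sum_add_distrib]
  refine Finset.sum_le_sum fun p _ => ?_
  have h0 := abs_nonneg (b p)
  have hite : ∀ c : Prop, [Decidable c] → 0 ≤ if c then |b p| else 0 := fun c _ => by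
    split_ifs
    · exact h0
    · exact le_rfl
  have i1 := hite (p = (0, N + 1))
  have i2 := hite (p = (0, N' + 1))
  have i3 := hite (p = (0, N))
  have i4 := hite (p = (1, N))
  by_cases hp : p = (0, N + 1) ∨ p = (0, N' + 1) ∨ p.2 = N
  · have h1 : p = (0, N + 1) ∨ p = (0, N' + 1) ∨ p = (0, N) ∨ p = (1, N) := by
      rcases hp with hp | hp | hp
      · exact Or.inl hp
      · exact Or.inr (Or.inl hp)
      · obtain ⟨i, m⟩ := p
        dsimp only at hp
        subst hp
        fin_cases i
        · exact Or.inr (Or.inr (Or.inl rfl))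
        · exact Or.inr (Or.inr (Or.inr rfl))
    rw [if_pos hp]
    rcases h1 with h1 | h1 | h1 | h1
    · rw [if_pos h1]
      linarith only [i2, i3, i4]
    · rw [if_pos h1]
      linarith only [i1, i3, i4]
    · rw [if_pos h1]
      linarith only [i1, i2, i4]
    · rw [if_pos h1]
      linarith only [i1, i2, i3]
  · rw [if_neg hp]
    linarith only [i1, i2, i3, i4]

/-- Let `x` be a combination of `U_1`, `U_2` and `V_{i₀,n+1}`. An element `w` is close to `x` as
soon as it is close to `x` in the first row on the blocks `N + 1`, `N' + 1` and `n + 1`, and the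
norm of `w + S (V_{1,N+1} - V_{1,N'+1})` is not much larger than what row `2 (N + 1)` contributes
with `x` in place of `w`. The blocks control the coefficients that the latter norm sees with a sign,
so that the norm controls the absolute sum of all others. -/
theorem exists_close_bound (h : Admissible δ M Δ) (he : IsL1Basis e) :
    ∃ C : ℝ, 0 < C ∧ ∀ (N N' n : ℕ+) (a₀ : Fin 2 → ℝ) (i₀ : Fin 2) (θ S ε : ℝ) (w : X δ M Δ e),
      N' ≠ N → N' + 1 ≠ N → 0 < ε →
      (∀ n' ∈ ({N, N', n} : Set ℕ+), ∀ k ∈ Finset.Icc 1 8, |ev (1, cell (n' + 1) k)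
        (w - comb δ M Δ e a₀ (Finsupp.single (i₀, n + 1) θ))| ≤ ε) →
      ‖w + S • (vX δ M Δ e 0 (N + 1) - vX δ M Δ e 0 (N' + 1))‖ ≤
        S * ((1 - δ) / 3 + 1 / 10) + rowGain δ N N' a₀ (Finsupp.single (i₀, n + 1) θ) + ε →
      ‖w - comb δ M Δ e a₀ (Finsupp.single (i₀, n + 1) θ)‖ ≤ C * ε := by
  obtain ⟨C, hC, hcoeff⟩ := exists_coeff_bound h e
  refine ⟨30 * C + 30, by linarith, fun N N' n a₀ i₀ θ S ε w hne hne' hε hblock hrow => ?_⟩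
  set b₀ : Fin 2 × ℕ+ →₀ ℝ := Finsupp.single (i₀, n + 1) θ with hb₀
  obtain ⟨a, b, hab⟩ := exists_comb_near w hε
  have hd : ∀ n' ∈ ({N, N', n} : Set ℕ+), (∀ i, |(a - a₀) i| ≤ C * (2 * ε)) ∧
      ∀ i, |(b - b₀) (i, n' + 1)| ≤ C * (2 * ε) ∧ |(b - b₀) (i, n')| ≤ C * (2 * ε) := by
    intro n' hn'
    refine hcoeff n' (a - a₀) (b - b₀) (2 * ε) fun k hk => ?_
    rw [← comb_sub]
    have h1 := hblock n' hn' k hk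
    have h2 := (abs_ev_le (1, cell (n' + 1) k) (w - comb δ M Δ e a b)).trans hab
    have h3 : comb δ M Δ e a b - comb δ M Δ e a₀ b₀ =
        (w - comb δ M Δ e a₀ b₀) - (w - comb δ M Δ e a b) := by abel
    rw [h3, map_sub]
    refine (abs_sub _ _).trans (by linarith)
  obtain ⟨ha, hN⟩ := hd N (by simp)
  obtain ⟨-, hN2⟩ := hd N' (by simp)
  obtain ⟨-, hn⟩ := hd n (by simp)
  have hgain : rowGain δ N N' a b ≤ rowGain δ N N' a₀ b₀ + 2 * ε := by
    have h1 := rowGain_le_norm (δ := δ) (M := M) (Δ := Δ) he hne hne' (S := S) a b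
    have h2 : ‖comb δ M Δ e a b + S • (vX δ M Δ e 0 (N + 1) - vX δ M Δ e 0 (N' + 1))‖ ≤
        ‖w + S • (vX δ M Δ e 0 (N + 1) - vX δ M Δ e 0 (N' + 1))‖ + ε := by
      have h3 : comb δ M Δ e a b + S • (vX δ M Δ e 0 (N + 1) - vX δ M Δ e 0 (N' + 1)) =
          w + S • (vX δ M Δ e 0 (N + 1) - vX δ M Δ e 0 (N' + 1)) -
            (w - comb δ M Δ e a b) := by abel
      rw [h3]
      exact (norm_sub_le _ _).trans (by linarith)
    linarith
  have hrest := restSum_sub_single_le N N' b (i₀, n + 1) θ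
  rw [← hb₀] at hrest
  have hsum := sum_abs_le_restSum N N' (b - b₀)
  have hnorm := norm_comb_le h he (a - a₀) (b - b₀)
  rw [← comb_sub] at hnorm
  have hfin : ‖w - comb δ M Δ e a₀ b₀‖ ≤ ε + ‖comb δ M Δ e a b - comb δ M Δ e a₀ b₀‖ := by
    have h3 : w - comb δ M Δ e a₀ b₀ =
        (w - comb δ M Δ e a b) + (comb δ M Δ e a b - comb δ M Δ e a₀ b₀) := by abel
    rw [h3]
    exact (norm_add_le _ _).trans (by linarith)
  have g1 := ha 0
  have g2 := ha 1
  have g3 := (hN 0).1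
  have g4 := (hN2 0).1
  have g5 := (hN 0).2
  have g6 := (hN 1).2
  have g7 := (hn i₀).1
  have g1' := abs_le.1 g1
  have g2' := abs_le.1 g2
  have g3' := abs_le.1 g3
  have g4' := abs_le.1 g4
  simp only [Pi.sub_apply, Finsupp.sub_apply] at g1' g2' g3' g4'
  unfold rowGain at hgain
  have hδ := h.delta_lt
  have hδ0 := h.delta_pos
  have hCε : 0 < C * ε := mul_pos hC hε
  have h9 : (1 - δ) / 3 * (b₀ (0, N + 1) - b (0, N + 1)) ≤ 1 / 3 * (C * (2 * ε)) := by
    refine (mul_le_mul_of_nonneg_left (by linarith : _ ≤ C * (2 * ε)) (by linarith)).trans ?_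
    exact mul_le_mul_of_nonneg_right (by linarith) (by linarith)
  linarith

end Blocks

/-! ### Near-isometric retractions almost fix the generators -/

section Retraction

variable {δ M Δ : ℝ} {e : ℕ+ → LInf ℕ+}

/-- A map `ρ` into a convex set `K` containing `0` that increases distances to the points of `K` at
most by the factor `1 + κ`. -/
structure NearContraction (κ : ℝ) (K : Set (X δ M Δ e)) (ρ : X δ M Δ e → X δ M Δ e) : Prop where
  convex : Convex ℝ K
  zero_mem : 0 ∈ K
  mem : ∀ x, ρ x ∈ K
  norm_sub_le : ∀ x, ∀ y ∈ K, ‖ρ x - y‖ ≤ (1 + κ) * ‖x - y‖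

theorem NearContraction.neg {κ : ℝ} {K : Set (X δ M Δ e)} {ρ : X δ M Δ e → X δ M Δ e}
    (hK : NearContraction κ K ρ) : NearContraction κ (-K) fun x => -ρ (-x) where
  convex := hK.convex.neg
  zero_mem := by simpa using hK.zero_mem
  mem x := by simpa using hK.mem (-x)
  norm_sub_le x y hy := by
    have h1 := hK.norm_sub_le (-x) (-y) hy
    have h2 : -ρ (-x) - y = -(ρ (-x) - -y) := by abel
    have h3 : x - y = -(-x - -y) := by abel
    rwa [h2, h3, norm_neg, norm_neg]

theorem norm_le_ev_of_peak {f : X δ M Δ e} {q₀ : ℕ+ × ℕ+}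
    (hf : ∀ q, q ≠ q₀ → |ev q f| ≤ ev q₀ f) : ‖f‖ ≤ ev q₀ f := by
  -- Any other coordinate shows that the peak value is nonnegative.
  have h0 : 0 ≤ ev q₀ f := by
    have hne : (q₀.1 + 1, q₀.2) ≠ q₀ := fun hh => by
      have h1 : (q₀.1 : ℕ) + 1 = q₀.1 := congrArg PNat.val (congrArg Prod.fst hh)
      omega
    exact (abs_nonneg _).trans (hf _ hne)
  refine norm_le_of_abs_ev_le fun q => ?_
  by_cases hq : q = q₀
  · rw [hq, abs_of_nonneg h0]
  · exact hf q hq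

/-- If the norm of `y - x` is attained, up to `ε`, at a coordinate, then a point `w` that is not
much further from `y` than `x` cannot be much beyond `x` at that coordinate. -/
theorem ev_sub_le_of_norm_le {κ ε s : ℝ} {w x y : X δ M Δ e} {q : ℕ+ × ℕ+} (hs : |s| = 1)
    (hw : ‖w - y‖ ≤ (1 + κ) * ‖x - y‖) (hy : ‖y - x‖ ≤ s * ev q (y - x) + ε) :
    s * ev q (x - w) ≤ ε + κ * ‖x - y‖ := by
  have h1 : s * ev q (y - w) ≤ ‖w - y‖ := by
    refine (le_abs_self _).trans ?_
    rw [abs_mul, hs, one_mul, norm_sub_rev]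
    exact abs_ev_le q _
  have h2 : ev q (x - w) = ev q (y - w) - ev q (y - x) := by
    simp only [map_sub]
    ring
  rw [norm_sub_rev y x] at hy
  rw [h2]
  linarith

theorem norm_sub_le_of_peak {ε S β s : ℝ} (hS : 0 ≤ S) (hSβ : 2 * β ≤ S * Δ) (hs : |s| = 1)
    {x y z : X δ M Δ e} {q₀ : ℕ+ × ℕ+} (hz : ∀ q, q ≠ q₀ → |ev q z| ≤ ev q₀ z - Δ)
    (hy : ‖y - (s * S) • z‖ ≤ ε) (hx : ‖x‖ ≤ β) : ‖y - x‖ ≤ s * ev q₀ (y - x) + 2 * ε := by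
  have hss : s * s = 1 := by rw [← abs_mul_abs_self, hs, one_mul]
  have hpeak : ‖S • z - s • x‖ ≤ ev q₀ (S • z - s • x) := by
    refine norm_le_ev_of_peak fun q hq => ?_
    have h3 := mul_le_mul_of_nonneg_left (hz q hq) hS
    have h4 : ∀ q, |s * ev q x| ≤ β := fun q => by
      rw [abs_mul, hs, one_mul]
      exact (abs_ev_le q x).trans hx
    have h5 := (abs_le.1 (h4 q₀)).2
    have h6 := h4 q
    rw [map_sub, map_sub, map_smul, map_smul, map_smul, map_smul, smul_eq_mul, smul_eq_mul,
      smul_eq_mul, smul_eq_mul]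
    refine (abs_sub _ _).trans ?_
    rw [abs_mul, abs_of_nonneg hS]
    linarith only [h3, h5, h6, hSβ]
  have h3 : y - x = (y - (s * S) • z) + s • (S • z - s • x) := by
    rw [smul_sub, smul_smul, smul_smul, hss, one_smul]
    abel
  have h5 : |s * ev q₀ (y - (s * S) • z)| ≤ ε := by
    rw [abs_mul, hs, one_mul]
    exact (abs_ev_le _ _).trans hy
  have h6 : s * ev q₀ (y - x) = s * ev q₀ (y - (s * S) • z) + ev q₀ (S • z - s • x) := by
    rw [h3, map_add, map_smul, smul_eq_mul, mul_add, ← mul_assoc, hss, one_mul]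
  have h7 := (abs_le.1 h5).1
  rw [h6, h3]
  refine (norm_add_le _ _).trans ?_
  rw [norm_smul, Real.norm_eq_abs, hs, one_mul]
  linarith only [h7, hy, hpeak]

/-- An element of norm at most `β` is almost fixed at a coordinate where a large multiple of `z`,
approximated in `K` with both signs, peaks. -/
theorem abs_ev_sub_le_of_peak {κ ε S β : ℝ} {K : Set (X δ M Δ e)} {ρ : X δ M Δ e → X δ M Δ e}
    (hK : NearContraction κ K ρ) (hκ : 0 ≤ κ) (hS : 0 ≤ S) (hSβ : 2 * β ≤ S * Δ)
    {z : X δ M Δ e} {q₀ : ℕ+ × ℕ+} (hz : ∀ q, q ≠ q₀ → |ev q z| ≤ ev q₀ z - Δ)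
    (hz4 : ‖z‖ ≤ 4) (h1 : ∃ y ∈ K, ‖y - S • z‖ ≤ ε) (h2 : ∃ y ∈ K, ‖y + S • z‖ ≤ ε)
    {x : X δ M Δ e} (hx : ‖x‖ ≤ β) :
    |ev q₀ (ρ x - x)| ≤ 2 * ε + κ * (4 * S + β + ε) := by
  have hSz : S * ‖z‖ ≤ S * 4 := mul_le_mul_of_nonneg_left hz4 hS
  have key : ∀ s : ℝ, |s| = 1 → (∃ y ∈ K, ‖y - (s * S) • z‖ ≤ ε) →
      s * ev q₀ (x - ρ x) ≤ 2 * ε + κ * (4 * S + β + ε) := by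
    rintro s hs ⟨y, hyK, hy⟩
    have h3 := ev_sub_le_of_norm_le hs (hK.norm_sub_le x y hyK)
      (norm_sub_le_of_peak hS hSβ hs hz hy hx)
    refine h3.trans (add_le_add_right (mul_le_mul_of_nonneg_left ?_ hκ) _)
    have h4 : x - y = x - (y - (s * S) • z) - (s * S) • z := by abel
    have h5 := norm_sub_le x (y - (s * S) • z)
    rw [h4]
    refine (norm_sub_le _ _).trans ?_
    rw [norm_smul, Real.norm_eq_abs, abs_mul, hs, one_mul, abs_of_nonneg hS]
    linarith only [h5, hx, hy, hSz]
  have k1 := key 1 abs_one (by rwa [one_mul])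
  have k2 := key (-1) (by rw [abs_neg, abs_one])
    (by simpa only [neg_mul, one_mul, neg_smul, sub_neg_eq_add] using h2)
  rw [map_sub] at k1 k2 ⊢
  exact abs_le.2 ⟨by linarith only [k1], by linarith only [k2]⟩

theorem norm_peak_le (h : Admissible δ M Δ) (he : IsL1Basis e) (P Q : Fin 2) (N N' : ℕ+) {a : ℝ}
    (ha : |a| ≤ 1) {k : ℕ} (hk : k ∈ Finset.Icc 1 8) : ‖peak δ M Δ e P Q a N N' k‖ ≤ 4 := by
  have ht1 := h.third_lt_tk hk
  have ht2 := h.tk_lt_half hk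
  have hY : ∀ n, ‖yX δ M Δ e n‖ ≤ 1 / 3 + 1 / 3 := fun n =>
    (norm_add_le _ _).trans (add_le_add (norm_vX_le h he 0 n) (norm_vX_le h he 1 n))
  have h1 : ‖a • uX δ M Δ e Q‖ ≤ 1 := by
    rw [norm_smul, Real.norm_eq_abs]
    exact mul_le_one₀ ha (norm_nonneg _) (norm_uX_le h he Q)
  have h2 : ‖uX δ M Δ e P + a • uX δ M Δ e Q‖ ≤ 2 :=
    (norm_add_le _ _).trans (by linarith [norm_uX_le h he P])
  have h3 : ‖yX δ M Δ e N - yX δ M Δ e N'‖ ≤ 2 :=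
    (norm_sub_le _ _).trans (by linarith [hY N, hY N'])
  refine (norm_add_le _ _).trans ?_
  rw [norm_smul, norm_smul, Real.norm_eq_abs, Real.norm_eq_abs,
    abs_of_pos (by linarith : 0 < 1 - tk M k), abs_of_pos (by linarith : 0 < tk M k / 2)]
  have h4 := mul_le_mul_of_nonneg_left h2 (by linarith : 0 ≤ 1 - tk M k)
  have h5 := mul_le_mul_of_nonneg_left h3 (by linarith : 0 ≤ tk M k / 2)
  linarith

/-- The finitely many elements whose multiples have to be available, with both signs, in a compact
set with a near-isometric retraction: those that peak on the blocks `N + 1` and `N' + 1` of the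
first row, and one whose norm is that of row `2 (N + 1)`. -/
def exposers (δ M Δ : ℝ) (e : ℕ+ → LInf ℕ+) (P Q : Fin 2) (a : ℝ) (N N' : ℕ+) :
    Set (X δ M Δ e) :=
  insert (vX δ M Δ e 0 (N + 1) - vX δ M Δ e 0 (N' + 1))
    (((fun k => peak δ M Δ e P Q a N N' k) '' (Finset.Icc 1 8 : Finset ℕ)) ∪
      ((fun k => peak δ M Δ e P Q a N' N k) '' (Finset.Icc 1 8 : Finset ℕ)))

theorem finite_exposers (P Q : Fin 2) (a : ℝ) (N N' : ℕ+) :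
    (exposers δ M Δ e P Q a N N').Finite :=
  (((Finset.finite_toSet _).image _).union ((Finset.finite_toSet _).image _)).insert _

/-- The data of the argument: parities, indices, the set `K` with its retraction `ρ`, and good
approximations in `K` of the multiples by `± S` of all exposers. -/
structure Exposed (κ ε S β : ℝ) (P Q : Fin 2) (a : ℝ) (N N' : ℕ+) (K : Set (X δ M Δ e))
    (ρ : X δ M Δ e → X δ M Δ e) : Prop extends NearContraction κ K ρ where
  parity_P : ((N : ℕ) + 1) % 2 = P
  parity_Q : (N : ℕ) % 2 = Q
  parity_N' : (N' : ℕ) % 2 = (N : ℕ) % 2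
  lt : N' < N
  abs_le : |a| ≤ 1
  kappa_nonneg : 0 ≤ κ
  eps_pos : 0 < ε
  S_nonneg : 0 ≤ S
  beta_le : 2 * β ≤ S * Δ
  beta_le' : β ≤ S / 20
  one_le_beta : 1 ≤ β
  pos : ∀ z ∈ exposers δ M Δ e P Q a N N', ∃ y ∈ K, ‖y - S • z‖ ≤ ε
  neg' : ∀ z ∈ exposers δ M Δ e P Q a N N', ∃ y ∈ K, ‖y + S • z‖ ≤ ε

variable {κ ε S β : ℝ} {P Q : Fin 2} {a : ℝ} {N N' : ℕ+} {K : Set (X δ M Δ e)}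
  {ρ : X δ M Δ e → X δ M Δ e}

theorem Exposed.neg (H : Exposed κ ε S β P Q a N N' K ρ) :
    Exposed κ ε S β P Q a N N' (-K) fun x => -ρ (-x) :=
  { H with
    toNearContraction := H.toNearContraction.neg
    pos := fun z hz => by
      obtain ⟨y, hy, hyz⟩ := H.neg' z hz
      refine ⟨-y, by simpa using hy, ?_⟩
      rwa [← norm_neg, neg_sub, sub_neg_eq_add, add_comm]
    neg' := fun z hz => by
      obtain ⟨y, hy, hyz⟩ := H.pos z hz
      refine ⟨-y, by simpa using hy, ?_⟩
      rwa [← norm_neg, neg_add, neg_neg, ← sub_eq_add_neg] }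

theorem Exposed.ne (H : Exposed κ ε S β P Q a N N' K ρ) : N' ≠ N := H.lt.ne

theorem Exposed.succ_ne (H : Exposed κ ε S β P Q a N N' K ρ) : N' + 1 ≠ N := fun hh => by
  have h1 : (N' : ℕ) + 1 = N := congrArg PNat.val hh
  have h2 := H.parity_N'
  omega

theorem Exposed.abs_ev_sub_le (H : Exposed κ ε S β P Q a N N' K ρ) (h : Admissible δ M Δ)
    (he : IsL1Basis e) {x : X δ M Δ e} (hx : ‖x‖ ≤ β) {k : ℕ} (hk : k ∈ Finset.Icc 1 8) :
    |ev (1, cell (N + 1) k) (ρ x - x)| ≤ 2 * ε + κ * (4 * S + β + ε) ∧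
      |ev (1, cell (N' + 1) k) (ρ x - x)| ≤ 2 * ε + κ * (4 * S + β + ε) := by
  have hz1 : peak δ M Δ e P Q a N N' k ∈ exposers δ M Δ e P Q a N N' :=
    Or.inr (Or.inl ⟨k, hk, rfl⟩)
  have hz2 : peak δ M Δ e P Q a N' N k ∈ exposers δ M Δ e P Q a N N' :=
    Or.inr (Or.inr ⟨k, hk, rfl⟩)
  have hP := H.parity_P
  have hQ := H.parity_Q
  have hN' := H.parity_N'
  constructor
  · exact abs_ev_sub_le_of_peak H.toNearContraction H.kappa_nonneg H.S_nonneg H.beta_le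
      (fun q hq => abs_ev_peak_le h he hP hQ hN' H.ne H.abs_le hk hq)
      (norm_peak_le h he P Q N N' H.abs_le hk) (H.pos _ hz1) (H.neg' _ hz1) hx
  · exact abs_ev_sub_le_of_peak H.toNearContraction H.kappa_nonneg H.S_nonneg H.beta_le
      (fun q hq => abs_ev_peak_le h he (by omega) (by omega) hN'.symm H.ne.symm H.abs_le hk hq)
      (norm_peak_le h he P Q N' N H.abs_le hk) (H.pos _ hz2) (H.neg' _ hz2) hx

theorem Exposed.norm_add_le (H : Exposed κ ε S β P Q a N N' K ρ) (h : Admissible δ M Δ)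
    (he : IsL1Basis e) {x : X δ M Δ e} (hx : ‖x‖ ≤ β) {ψ : ℝ} (hψ : 0 ≤ ψ)
    (h1 : ∀ q, |ev (idx 0 (N + 1), q) x| ≤ ψ) (h2 : ∀ q, |ev (idx 0 (N' + 1), q) x| ≤ ψ) :
    ‖ρ x + S • (vX δ M Δ e 0 (N + 1) - vX δ M Δ e 0 (N' + 1))‖ ≤
      S * ((1 - δ) / 3 + 1 / 10) + ψ + (2 * ε + κ * (4 * S + β + ε)) := by
  obtain ⟨y, hyK, hy⟩ := H.neg' _ (Set.mem_insert _ _)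
  set z := vX δ M Δ e 0 (N + 1) - vX δ M Δ e 0 (N' + 1) with hz
  have hS := H.S_nonneg
  have h3 := norm_add_rowPeak_le h he H.ne H.parity_N' hS hψ (hx.trans H.beta_le') h1 h2
  rw [← hz] at h3
  have hz1 : ‖z‖ ≤ 4 :=
    (norm_sub_le _ _).trans (by linarith [norm_vX_le h he 0 (N + 1), norm_vX_le h he 0 (N' + 1)])
  have hxz : ‖x + S • z‖ ≤ 4 * S + β := by
    refine (_root_.norm_add_le _ _).trans ?_
    rw [norm_smul, Real.norm_eq_abs, abs_of_nonneg hS]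
    have := mul_le_mul_of_nonneg_left hz1 hS
    linarith
  have h4 : ‖x - y‖ ≤ ‖x + S • z‖ + ε := by
    have : x - y = (x + S • z) - (y + S • z) := by abel
    rw [this]
    exact (_root_.norm_sub_le _ _).trans (by linarith)
  have h5 := H.norm_sub_le x y hyK
  have h6 : ‖ρ x + S • z‖ ≤ ‖ρ x - y‖ + ε := by
    have : ρ x + S • z = (ρ x - y) + (y + S • z) := by abel
    rw [this]
    exact (_root_.norm_add_le _ _).trans (by linarith)
  have h7 : κ * ‖x - y‖ ≤ κ * (4 * S + β + ε) :=
    mul_le_mul_of_nonneg_left (by linarith) H.kappa_nonneg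
  linarith

theorem restSum_single (N N' : ℕ+) (p : Fin 2 × ℕ+) (θ : ℝ) :
    restSum N N' (Finsupp.single p θ) =
      if p = (0, N + 1) ∨ p = (0, N' + 1) ∨ p.2 = N then 0 else |θ| :=
  Finsupp.sum_single_index (by simp)

theorem comb_single (i : Fin 2) (n : ℕ+) :
    comb δ M Δ e 0 (Finsupp.single (i, n) 1) = vX δ M Δ e i n := by
  simp [comb, Finsupp.linearCombination_single]

/-- Under a near-isometric retraction the multiples `β U_j` are almost fixed, and so is `V_{i,n+1}`
with `n ≥ N` once this is known in the first row on its own block `n + 1`. The blocks `N + 1` and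
`N' + 1` and the row `2 (N + 1)`, which `exists_close_bound` needs besides, are controlled by the
exposers. -/
theorem Exposed.exists_const (h : Admissible δ M Δ) (he : IsL1Basis e) : ∃ C : ℝ, 0 < C ∧
    ∀ (κ ε S β : ℝ) (P Q : Fin 2) (a : ℝ) (N N' : ℕ+) (K : Set (X δ M Δ e))
      (ρ : X δ M Δ e → X δ M Δ e), Exposed κ ε S β P Q a N N' K ρ →
      (∀ j, ‖ρ (β • uX δ M Δ e j) - β • uX δ M Δ e j‖ ≤ C * (2 * ε + κ * (4 * S + β + ε))) ∧
      ∀ n, N ≤ n → ∀ i, (∀ k ∈ Finset.Icc 1 8, |ev (1, cell (n + 1) k)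
        (ρ (vX δ M Δ e i (n + 1)) - vX δ M Δ e i (n + 1))| ≤ 2 * ε + κ * (4 * S + β + ε)) →
        ‖ρ (vX δ M Δ e i (n + 1)) - vX δ M Δ e i (n + 1)‖ ≤
          C * (2 * ε + κ * (4 * S + β + ε)) := by
  obtain ⟨C, hC, hclose⟩ := exists_close_bound h he
  refine ⟨C, hC, fun κ ε S β P Q a N N' K ρ H => ⟨fun j => ?_, fun n hn i hblock => ?_⟩⟩
  · have hβ := H.one_le_beta
    have hpos : 0 < 2 * ε + κ * (4 * S + β + ε) := by
      have := H.kappa_nonneg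
      have := H.eps_pos
      have := H.S_nonneg
      positivity
    have hx : comb δ M Δ e (Pi.single j β) (Finsupp.single (0, N + 1) 0) =
        β • uX δ M Δ e j := by
      fin_cases j <;> simp [comb]
    have hxβ : ‖β • uX δ M Δ e j‖ ≤ β := by
      rw [norm_smul, Real.norm_eq_abs, abs_of_nonneg (by linarith)]
      exact mul_le_of_le_one_right (by linarith) (norm_uX_le h he j)
    have hgain : rowGain δ N N' (Pi.single j β) (Finsupp.single (0, N + 1) 0) = β / 10 := by
      have : (Pi.single j β : Fin 2 → ℝ) 0 + (Pi.single j β : Fin 2 → ℝ) 1 = β := by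
        fin_cases j <;> simp
      rw [rowGain, this, restSum_single]
      simp
    have hrow : ∀ p : ℕ+, p ≠ 1 → ∀ q, |ev (p, q) (β • uX δ M Δ e j)| ≤ β / 10 := by
      intro p hp q
      rw [map_smul, smul_eq_mul, ev_uX, abs_mul, abs_of_nonneg (by linarith)]
      have := mul_le_mul_of_nonneg_left (abs_Ufun_le (M := M) (Δ := Δ) he hp q j)
        (by linarith : 0 ≤ β)
      linarith
    have := hclose N N' N (Pi.single j β) 0 0 S (2 * ε + κ * (4 * S + β + ε))
      (ρ (β • uX δ M Δ e j)) H.ne H.succ_ne hpos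
    rw [hx, hgain] at this
    refine this (fun n' hn' k hk => ?_) ?_
    · have h1 := H.abs_ev_sub_le h he hxβ hk
      rcases hn' with rfl | rfl | rfl
      · exact h1.1
      · exact h1.2
      · exact h1.1
    · exact H.norm_add_le h he hxβ (by linarith) (hrow _ (idx_ne_one _ _))
        (hrow _ (idx_ne_one _ _))
  · have hβ := H.one_le_beta
    have hδ := h.delta_lt
    have hpos : 0 < 2 * ε + κ * (4 * S + β + ε) := by
      have := H.kappa_nonneg
      have := H.eps_pos
      have := H.S_nonneg
      positivity
    have hxβ : ‖vX δ M Δ e i (n + 1)‖ ≤ β := (norm_vX_le h he i _).trans (by linarith)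
    have hN'n : ¬ ((i, n + 1) = ((0 : Fin 2), N' + 1)) := fun hh => by
      have := add_right_cancel (Prod.mk.inj hh).2
      exact absurd (this ▸ hn) (not_le.2 H.lt)
    have hNn : n + 1 ≠ N := fun hh => by
      have h1 : (n : ℕ) + 1 = N := congrArg PNat.val hh
      have h2 : (N : ℕ) ≤ n := hn
      omega
    have := hclose N N' n 0 i 1 S (2 * ε + κ * (4 * S + β + ε))
      (ρ (vX δ M Δ e i (n + 1))) H.ne H.succ_ne hpos
    rw [comb_single] at this
    refine this (fun n' hn' k hk => ?_) ?_
    · have h1 := H.abs_ev_sub_le h he hxβ hk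
      rcases hn' with rfl | rfl | rfl
      · exact h1.1
      · exact h1.2
      · exact hblock k hk
    have hN'row : ∀ q, |ev (idx 0 (N' + 1), q) (vX δ M Δ e i (n + 1))| ≤ 1 / 10 := fun q => by
      rw [ev_vX]
      exact abs_Vfun_le_tenth he (idx_ne_one _ _)
        (fun hh => hN'n (by rw [(idx_injective hh).1, (idx_injective hh).2])) q
    by_cases hNN : (i, n + 1) = ((0 : Fin 2), N + 1)
    · have hgain : rowGain δ N N' 0 (Finsupp.single (i, n + 1) 1) = (1 - δ) / 3 := by
        rw [rowGain, restSum_single, if_pos (Or.inl hNN), hNN, Finsupp.single_eq_same,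
          Finsupp.single_apply, if_neg (by rw [← hNN]; exact hN'n)]
        simp
      rw [hgain]
      refine H.norm_add_le h he hxβ (by linarith) (fun q => ?_)
        (fun q => (hN'row q).trans (by linarith))
      obtain ⟨h1, h2⟩ := Prod.mk.inj hNN
      rw [h1, h2]
      exact abs_Vfun_idx_le h he 0 (N + 1) q
    · have hgain : rowGain δ N N' 0 (Finsupp.single (i, n + 1) 1) = 1 / 10 := by
        rw [rowGain, restSum_single, if_neg (by simp only [hNN, hN'n, hNn, or_self,
          not_false_eq_true]), Finsupp.single_apply, if_neg hNN, Finsupp.single_apply, if_neg hN'n]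
        simp
      rw [hgain]
      refine H.norm_add_le h he hxβ (by norm_num) (fun q => ?_) hN'row
      rw [ev_vX]
      exact abs_Vfun_le_tenth he (idx_ne_one _ _)
        (fun hh => hNN (by rw [(idx_injective hh).1, (idx_injective hh).2])) q

end Retraction

/-! ### Running through all generators at a fixed scale -/

section Chain

variable {δ M Δ : ℝ} {e : ℕ+ → LInf ℕ+}

/-- A convex set that approximates multiples of `U_P`, `V_{1,n}` and `V_{2,n}` approximates the
moving element of `abs_ev_moving_le` equally well, because the coefficients of `V_{1,n}` and
`V_{2,n}` add up to less than `1` and those of `U_P` are supplied at the larger scale `β`. -/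
theorem exists_mem_near_moving {K : Set (X δ M Δ e)} (hK : Convex ℝ K) (h0 : (0 : X δ M Δ e) ∈ K)
    {β t s η : ℝ} (hβ : 0 < β) (ht0 : 0 ≤ t) (ht1 : t ≤ 1) (ht : 2 * (1 - t) ≤ (1 - 2 * t) * β)
    (hη : 0 ≤ η) (P : Fin 2) (n : ℕ+) (hU : ∃ y ∈ K, ‖y - (s * β) • uX δ M Δ e P‖ ≤ η)
    (hV : ∀ i, ∃ y ∈ K, ‖y - s • vX δ M Δ e i n‖ ≤ η) :
    ∃ y ∈ K, ‖y - s • ((2 * (1 - t)) • uX δ M Δ e P + t • yX δ M Δ e n)‖ ≤ η := by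
  obtain ⟨w, hwK, hw⟩ := hU
  obtain ⟨w0, hw0K, hw0⟩ := hV 0
  obtain ⟨w1, hw1K, hw1⟩ := hV 1
  set c := 2 * (1 - t) / β with hc
  have hcβ : c * β = 2 * (1 - t) := div_mul_cancel₀ _ hβ.ne'
  have hc0 : 0 ≤ c := div_nonneg (by linarith) hβ.le
  have hc1 : c ≤ 1 - 2 * t := (div_le_iff₀ hβ).2 ht
  refine ⟨t • w0 + t • w1 + c • w, ?_, ?_⟩
  · have := hK.sum_mem (t := Finset.univ) (w := ![t, t, c, 1 - 2 * t - c])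
      (z := ![w0, w1, w, 0])
      (fun i _ => by fin_cases i <;> simp <;> linarith)
      (by simp [Fin.sum_univ_four]; ring)
      (fun i _ => by fin_cases i <;> simp [hw0K, hw1K, hwK, h0])
    simpa [Fin.sum_univ_four] using this
  · have h1 : t • w0 + t • w1 + c • w -
        s • ((2 * (1 - t)) • uX δ M Δ e P + t • yX δ M Δ e n) =
        t • (w0 - s • vX δ M Δ e 0 n) + t • (w1 - s • vX δ M Δ e 1 n) +
          c • (w - (s * β) • uX δ M Δ e P) := by
      rw [← hcβ, yX]
      module
    have h2 : ∀ {r : ℝ} {v : X δ M Δ e}, 0 ≤ r → ‖v‖ ≤ η → ‖r • v‖ ≤ r * η := fun hr hv => by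
      rw [norm_smul, Real.norm_eq_abs, abs_of_nonneg hr]
      exact mul_le_mul_of_nonneg_left hv hr
    rw [h1]
    refine (norm_add₃_le).trans ?_
    have h3 := h2 ht0 hw0
    have h4 := h2 ht0 hw1
    have h5 := h2 hc0 hw
    have h6 : (2 * t + c) * η ≤ 1 * η := mul_le_mul_of_nonneg_right (by linarith) hη
    linarith

theorem norm_moving_le (h : Admissible δ M Δ) (he : IsL1Basis e) (P : Fin 2) (n : ℕ+) {k : ℕ}
    (hk : k ∈ Finset.Icc 1 8) :
    ‖(2 * (1 - tk M k)) • uX δ M Δ e P + tk M k • yX δ M Δ e n‖ ≤ 3 := by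
  have ht1 := h.third_lt_tk hk
  have ht2 := h.tk_lt_half hk
  have hY : ‖yX δ M Δ e n‖ ≤ 1 / 3 + 1 / 3 :=
    (norm_add_le _ _).trans (add_le_add (norm_vX_le h he 0 n) (norm_vX_le h he 1 n))
  refine (norm_add_le _ _).trans ?_
  rw [norm_smul, norm_smul, Real.norm_eq_abs, Real.norm_eq_abs,
    abs_of_pos (by linarith : 0 < 2 * (1 - tk M k)), abs_of_pos (by linarith : 0 < tk M k)]
  have h4 := mul_le_mul_of_nonneg_left (norm_uX_le h he P) (by linarith : 0 ≤ 2 * (1 - tk M k))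
  have h5 := mul_le_mul_of_nonneg_left hY (by linarith : 0 ≤ tk M k)
  linarith

/-- A perturbation of size `Δ/8` of the moving element does not destroy its peak. -/
theorem norm_sub_le_of_near_moving (h : Admissible δ M Δ) (he : IsL1Basis e) {P : Fin 2} {n : ℕ+}
    (hP : ((n : ℕ) + 1) % 2 = P) {s : ℝ} (hs : |s| = 1) (i : Fin 2) {k : ℕ}
    (hk : k ∈ Finset.Icc 1 8) {y : X δ M Δ e}
    (hy : ‖y - s • ((2 * (1 - tk M k)) • uX δ M Δ e P + tk M k • yX δ M Δ e n)‖ ≤ Δ / 8) :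
    ‖y - vX δ M Δ e i (n + 1)‖ ≤ s * ev (1, cell (n + 1) k) (y - vX δ M Δ e i (n + 1)) := by
  have hss : s * s = 1 := by rw [← abs_mul_abs_self, hs, one_mul]
  have hΔ := h.Delta_pos
  have hpeak := fun q hq => abs_ev_moving_le (q := q) h he hP hs i hk hq
  set v := (2 * (1 - tk M k)) • uX δ M Δ e P + tk M k • yX δ M Δ e n with hv
  set x := vX δ M Δ e i (n + 1) with hx
  have h1 : s • (y - x) = (v - s • x) + s • (y - s • v) := by
    rw [smul_sub s y (s • v), smul_smul, hss, one_smul, smul_sub]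
    abel
  have h2 : ∀ q, |ev q (s • (y - s • v))| ≤ Δ / 8 := fun q => by
    rw [map_smul, smul_eq_mul, abs_mul, hs, one_mul]
    exact (abs_ev_le q _).trans hy
  have h3 : ‖s • (y - x)‖ ≤ ev (1, cell (n + 1) k) (s • (y - x)) := by
    refine norm_le_ev_of_peak fun q hq => ?_
    rw [h1, map_add, map_add]
    refine (abs_add_le _ _).trans ?_
    have h4 := (abs_le.1 (h2 (1, cell (n + 1) k))).1
    linarith only [h4, h2 q, hpeak q hq, hΔ]
  rwa [norm_smul, Real.norm_eq_abs, hs, one_mul, map_smul, smul_eq_mul] at h3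

variable {κ ε S β : ℝ} {P Q : Fin 2} {a : ℝ} {N N' : ℕ+} {K : Set (X δ M Δ e)}
  {ρ : X δ M Δ e → X δ M Δ e}

/-- If `K` approximates `± V_{i,n}` and `± β U_j` up to `Δ/8`, then `V_{i,n+1}` is almost fixed at
the block `n + 1` of the first row. The bound does not depend on the quality of the approximations,
so that errors do not build up with `n`. -/
theorem Exposed.abs_ev_sub_le_succ (H : Exposed κ ε S β P Q a N N' K ρ) (h : Admissible δ M Δ)
    (he : IsL1Basis e) (hβ : ∀ k ∈ Finset.Icc 1 8, 2 * (1 - tk M k) ≤ (1 - 2 * tk M k) * β)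
    (hU : ∀ s : ℝ, |s| = 1 → ∀ j, ∃ y ∈ K, ‖y - (s * β) • uX δ M Δ e j‖ ≤ Δ / 8) {n : ℕ+}
    (hV : ∀ s : ℝ, |s| = 1 → ∀ i, ∃ y ∈ K, ‖y - s • vX δ M Δ e i n‖ ≤ Δ / 8) (i : Fin 2)
    {k : ℕ} (hk : k ∈ Finset.Icc 1 8) :
    |ev (1, cell (n + 1) k) (ρ (vX δ M Δ e i (n + 1)) - vX δ M Δ e i (n + 1))| ≤
      2 * ε + κ * (4 * S + β + ε) := by
  have hΔ := h.Delta_pos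
  have hΔ' := h.Delta_lt_delta
  have hδ := h.delta_lt
  have ht1 := h.third_lt_tk hk
  have ht2 := h.tk_lt_half hk
  have hε := H.eps_pos
  have hβ1 := H.one_le_beta
  have hβS := H.beta_le'
  let P' : Fin 2 := ⟨((n : ℕ) + 1) % 2, Nat.mod_lt _ (by norm_num)⟩
  have key : ∀ s : ℝ, |s| = 1 → s * ev (1, cell (n + 1) k)
      (vX δ M Δ e i (n + 1) - ρ (vX δ M Δ e i (n + 1))) ≤ 2 * ε + κ * (4 * S + β + ε) := by
    intro s hs
    obtain ⟨y, hyK, hy⟩ := exists_mem_near_moving H.convex H.zero_mem (by linarith)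
      (by linarith) (by linarith) (hβ k hk) (by linarith : 0 ≤ Δ / 8) P' n (hU s hs P') (hV s hs)
    have h1 := norm_sub_le_of_near_moving h he (P := P') rfl hs i hk hy
    have h2 := ev_sub_le_of_norm_le (ε := 0) hs (H.norm_sub_le (vX δ M Δ e i (n + 1)) y hyK)
      (by linarith)
    refine h2.trans ?_
    have h3 : ‖vX δ M Δ e i (n + 1) - y‖ ≤ 4 * S + β + ε := by
      have h4 := norm_moving_le h he P' n hk
      set v := (2 * (1 - tk M k)) • uX δ M Δ e P' + tk M k • yX δ M Δ e n with hv
      have h5 : vX δ M Δ e i (n + 1) - y = vX δ M Δ e i (n + 1) - (y - s • v) - s • v := by abel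
      have h6 := _root_.norm_sub_le (vX δ M Δ e i (n + 1)) (y - s • v)
      have h7 := norm_vX_le h he i (n + 1)
      rw [h5]
      refine (_root_.norm_sub_le _ _).trans ?_
      rw [norm_smul, Real.norm_eq_abs, hs, one_mul]
      linarith only [h4, h6, h7, hy, hβ1, hβS, hΔ', hδ, hε]
    have h4 := mul_le_mul_of_nonneg_left h3 H.kappa_nonneg
    linarith
  have k1 := key 1 abs_one
  have k2 := key (-1) (by rw [abs_neg, abs_one])
  rw [map_sub] at k1 k2 ⊢
  exact _root_.abs_le.2 ⟨by linarith only [k1], by linarith only [k2]⟩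

theorem exists_mem_near_of_signs {η : ℝ} {x : X δ M Δ e} (H : NearContraction κ K ρ)
    (h1 : ‖ρ x - x‖ ≤ η) (h2 : ‖-ρ (-x) - x‖ ≤ η) (s : ℝ) (hs : |s| = 1) :
    ∃ y ∈ K, ‖y - s • x‖ ≤ η := by
  rcases (abs_eq zero_le_one).1 hs with rfl | rfl
  · exact ⟨ρ x, H.mem x, by rwa [one_smul]⟩
  · refine ⟨ρ (-x), H.mem _, ?_⟩
    have h3 : ρ (-x) - (-1 : ℝ) • x = -(-ρ (-x) - x) := by module
    rwa [h3, norm_neg]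

/-- The constants can be chosen, depending only on `δ`, `M`, `Δ` and `e`, such that a set `K` with
all approximations also approximates every `V_{i,n}` with `n > N`. -/
theorem exists_constants (h : Admissible δ M Δ) (he : IsL1Basis e) :
    ∃ κ ε S β : ℝ, 0 < κ ∧ 0 < ε ∧ 0 ≤ S ∧ 2 * β ≤ S * Δ ∧ β ≤ S / 20 ∧ 1 ≤ β ∧
      ∀ (P Q : Fin 2) (a : ℝ) (N N' : ℕ+) (K : Set (X δ M Δ e)) (ρ : X δ M Δ e → X δ M Δ e),
        Exposed κ ε S β P Q a N N' K ρ → ∀ n, N ≤ n → ∀ s : ℝ, |s| = 1 → ∀ i,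
          ∃ y ∈ K, ‖y - s • vX δ M Δ e i (n + 1)‖ ≤ Δ / 8 := by
  obtain ⟨C, hC, hconst⟩ := Exposed.exists_const h he
  have hΔ := h.Delta_pos
  have hM : 0 < M := by linarith [h.M_gt]
  -- Since `1 - 2 t(k) = 2 k / M`, the weight `2 (1 - t(k)) / β` of `β U_P` fits next to the weights
  -- `t(k)` of `V_{1,n}` and `V_{2,n}` in a convex combination if `β` is of the order of `M`.
  set β : ℝ := 1 + M / 2 with hβdef
  have hβ1 : 1 ≤ β := by linarith
  set S : ℝ := 2 * β / Δ with hSdef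
  have hSΔ : S * Δ = 2 * β := div_mul_cancel₀ _ hΔ.ne'
  have hS0 : 0 ≤ S := by positivity
  have hβS : β ≤ S / 20 := by
    have : S * Δ ≤ S * (1 / 60) :=
      mul_le_mul_of_nonneg_left (by linarith [h.Delta_lt_delta, h.delta_lt]) hS0
    linarith
  set ε : ℝ := Δ / (32 * C) with hεdef
  have hε0 : 0 < ε := by positivity
  have hD : 0 < 4 * S + β + ε := by positivity
  set κ : ℝ := Δ / (16 * C * (4 * S + β + ε)) with hκdef
  have hκ0 : 0 < κ := by positivity
  have hE : C * (2 * ε + κ * (4 * S + β + ε)) = Δ / 8 := by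
    have h1 : C * (2 * ε) = Δ / 16 := by
      rw [hεdef]
      field_simp
      norm_num
    have h2 : C * (κ * (4 * S + β + ε)) = Δ / 16 := by
      rw [hκdef]
      field_simp
    rw [mul_add, h1, h2]
    ring
  have hβt : ∀ k ∈ Finset.Icc 1 8, 2 * (1 - tk M k) ≤ (1 - 2 * tk M k) * β := by
    intro k hk
    have hk1 : (1 : ℝ) ≤ k := by exact_mod_cast (Finset.mem_Icc.1 hk).1
    have h1 : (1 - 2 * tk M k) * β = 2 * (k / M) + k := by
      unfold tk
      rw [hβdef]
      field_simp
      ring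
    rw [h1]
    unfold tk
    linarith
  refine ⟨κ, ε, S, β, hκ0, hε0, hS0, hSΔ.ge, hβS, hβ1, fun P Q a N N' K ρ H => ?_⟩
  obtain ⟨hU1, hV1⟩ := hconst _ _ _ _ _ _ _ _ _ _ _ H
  obtain ⟨hU2, hV2⟩ := hconst _ _ _ _ _ _ _ _ _ _ _ H.neg
  rw [hE] at hU1 hV1 hU2 hV2
  have hU : ∀ s : ℝ, |s| = 1 → ∀ j, ∃ y ∈ K, ‖y - (s * β) • uX δ M Δ e j‖ ≤ Δ / 8 := by
    intro s hs j
    simp only [mul_smul]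
    exact exists_mem_near_of_signs H.toNearContraction (hU1 j) (hU2 j) s hs
  have hmain : ∀ m : ℕ, ∀ n : ℕ+, (n : ℕ) = N + m → ∀ s : ℝ, |s| = 1 → ∀ i,
      ∃ y ∈ K, ‖y - s • vX δ M Δ e i (n + 1)‖ ≤ Δ / 8 := by
    intro m
    induction m with
    | zero =>
      intro n hn s hs i
      obtain rfl : n = N := PNat.eq hn
      have hx : ‖vX δ M Δ e i (n + 1)‖ ≤ β := (norm_vX_le h he i _).trans (by linarith)
      exact exists_mem_near_of_signs H.toNearContraction
        (hV1 n le_rfl i fun k hk => (H.abs_ev_sub_le h he hx hk).1)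
        (hV2 n le_rfl i fun k hk => (H.neg.abs_ev_sub_le h he hx hk).1) s hs
    | succ m ih =>
      intro n hn s hs i
      obtain ⟨n', rfl⟩ : ∃ n' : ℕ+, n = n' + 1 := by
        refine ⟨⟨N + m, by have := N.pos; omega⟩, PNat.eq ?_⟩
        rw [hn]
        rfl
      have hn' : (n' : ℕ) = N + m := by
        rw [PNat.add_coe, PNat.one_coe] at hn
        omega
      have hle : N ≤ n' + 1 := by
        rw [← PNat.coe_le_coe, PNat.add_coe]
        omega
      have hV := ih n' hn'
      have hU' : ∀ s : ℝ, |s| = 1 → ∀ j, ∃ y ∈ -K, ‖y - (s * β) • uX δ M Δ e j‖ ≤ Δ / 8 := by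
        intro s hs j
        obtain ⟨y, hy, hys⟩ := hU (-s) (by rwa [abs_neg]) j
        refine ⟨-y, by simpa using hy, ?_⟩
        have h1 : ∀ v : X δ M Δ e, -y - v = -(y - -v) := fun v => by abel
        rwa [h1, norm_neg, ← neg_smul, ← neg_mul]
      have hV' : ∀ s : ℝ, |s| = 1 → ∀ i, ∃ y ∈ -K, ‖y - s • vX δ M Δ e i (n' + 1)‖ ≤ Δ / 8 := by
        intro s hs j
        obtain ⟨y, hy, hys⟩ := hV (-s) (by rwa [abs_neg]) j
        refine ⟨-y, by simpa using hy, ?_⟩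
        have h1 : ∀ v : X δ M Δ e, -y - v = -(y - -v) := fun v => by abel
        rwa [h1, norm_neg, ← neg_smul]
      exact exists_mem_near_of_signs H.toNearContraction
        (hV1 (n' + 1) hle i fun k hk => H.abs_ev_sub_le_succ h he hβt hU hV i hk)
        (hV2 (n' + 1) hle i fun k hk => H.neg.abs_ev_sub_le_succ h he hβt hU' hV' i hk) s hs
  intro n hn
  exact hmain (n - N) n (by have : (N : ℕ) ≤ n := hn; omega)

/-- The `V_{1,n}` with `n` of a fixed parity are separated. -/
theorem le_norm_vX_sub (h : Admissible δ M Δ) {m n : ℕ+} (hmn : m ≠ n)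
    (hpar : (m : ℕ) % 2 = (n : ℕ) % 2) : 1 / 5 ≤ ‖vX δ M Δ e 0 n - vX δ M Δ e 0 m‖ := by
  have hk : 1 ∈ Finset.Icc 1 8 := by decide
  have hmn' : (m : ℕ) ≠ n := fun hh => hmn (PNat.eq hh)
  have hb := blk_cell (n + 1) hk
  have h1 := (le_abs_self _).trans
    (abs_ev_le (1, cell (n + 1) 1) (vX δ M Δ e 0 n - vX δ M Δ e 0 m))
  rw [map_sub, ev_vX, ev_vX, Vfun_succ hb, Vfun_other (by omega) (by omega), pos_cell _ hk] at h1
  have h2 := le_vk h.M_gt hk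
  have h3 := h.deltaM_lt
  have h4 := h.delta_lt
  have h5 : bump Δ 7 1 = 0 := by simp [bump]
  rw [h5] at h1
  linarith

theorem not_isCompact_of_near (h : Admissible δ M Δ) {N : ℕ+}
    (hK : ∀ n, N ≤ n → ∃ y ∈ K, ‖y - vX δ M Δ e 0 (n + 1)‖ ≤ Δ / 8) : ¬ IsCompact K := by
  intro hc
  have hΔ' := h.Delta_lt_delta
  have hδ := h.delta_lt
  let f : ℕ → ℕ+ := fun m => ⟨N + 2 * m, by have := N.pos; omega⟩
  have hf : ∀ m, N ≤ f m := fun m => by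
    rw [← PNat.coe_le_coe]
    exact Nat.le_add_right _ _
  choose y hy hyn using fun m => hK (f m) (hf m)
  obtain ⟨z, -, φ, hφ, hlim⟩ := hc.tendsto_subseq hy
  obtain ⟨m₀, hm₀⟩ := Metric.cauchySeq_iff.1 hlim.cauchySeq (1 / 10) (by norm_num)
  have h1 := hm₀ m₀ le_rfl (m₀ + 1) (Nat.le_succ _)
  have hlt : φ m₀ < φ (m₀ + 1) := hφ (Nat.lt_succ_self m₀)
  have h2 : 1 / 5 ≤ ‖vX δ M Δ e 0 (f (φ m₀) + 1) - vX δ M Δ e 0 (f (φ (m₀ + 1)) + 1)‖ := by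
    apply le_norm_vX_sub h
    · intro hh
      have h3 : (N : ℕ) + 2 * φ (m₀ + 1) + 1 = N + 2 * φ m₀ + 1 := congrArg PNat.val hh
      omega
    · change ((N : ℕ) + 2 * φ (m₀ + 1) + 1) % 2 = ((N : ℕ) + 2 * φ m₀ + 1) % 2
      omega
  rw [dist_eq_norm] at h1
  have h3 : vX δ M Δ e 0 (f (φ m₀) + 1) - vX δ M Δ e 0 (f (φ (m₀ + 1)) + 1) =
      (y (φ m₀) - y (φ (m₀ + 1))) - (y (φ m₀) - vX δ M Δ e 0 (f (φ m₀) + 1)) +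
        (y (φ (m₀ + 1)) - vX δ M Δ e 0 (f (φ (m₀ + 1)) + 1)) := by abel
  rw [h3] at h2
  have h4 := norm_add_le ((y (φ m₀) - y (φ (m₀ + 1))) - (y (φ m₀) -
    vX δ M Δ e 0 (f (φ m₀) + 1))) (y (φ (m₀ + 1)) - vX δ M Δ e 0 (f (φ (m₀ + 1)) + 1))
  have h5 := norm_sub_le (y (φ m₀) - y (φ (m₀ + 1))) (y (φ m₀) - vX δ M Δ e 0 (f (φ m₀) + 1))
  have h6 := hyn (φ m₀)
  have h7 := hyn (φ (m₀ + 1))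
  change ‖y (φ m₀) - y (φ (m₀ + 1))‖ < 1 / 10 at h1
  linarith

end Chain

/-! ### Directions in a generating convex set -/

section Directions

variable {E : Type*} [NormedAddCommGroup E] [NormedSpace ℝ E] {K : Set E}

/-- The linear span of the differences of points of `K`. -/
def directions (K : Set E) : Submodule ℝ E := Submodule.span ℝ {d | ∃ x ∈ K, ∃ y ∈ K, d = y - x}

theorem add_smul_mem_of_le (hK : Convex ℝ K) {x d : E} {r s : ℝ} (hx : x ∈ K) (hr : 0 < r)
    (hd : x + r • d ∈ K) (hs : 0 ≤ s) (hsr : s ≤ r) : x + s • d ∈ K := by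
  have h1 := hK.add_smul_mem hx hd (t := s / r)
    ⟨div_nonneg hs hr.le, div_le_one_of_le₀ hsr hr.le⟩
  rwa [smul_smul, div_mul_cancel₀ _ hr.ne'] at h1

theorem exists_add_smul_mem (hK : Convex ℝ K) (hne : K.Nonempty) {d : E}
    (hd : d ∈ directions K) : ∃ x ∈ K, ∃ r : ℝ, 0 < r ∧ x + r • d ∈ K := by
  induction hd using Submodule.span_induction with
  | mem d hd =>
    obtain ⟨x, hx, y, hy, rfl⟩ := hd
    exact ⟨x, hx, 1, one_pos, by rwa [one_smul, add_sub_cancel]⟩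
  | zero =>
    obtain ⟨x, hx⟩ := hne
    exact ⟨x, hx, 1, one_pos, by rwa [smul_zero, add_zero]⟩
  | add d d' _ _ h h' =>
    obtain ⟨x, hx, r, hr, hd⟩ := h
    obtain ⟨x', hx', r', hr', hd'⟩ := h'
    have hm : 0 < min r r' := lt_min hr hr'
    have h1 := add_smul_mem_of_le hK hx hr hd hm.le (min_le_left _ _)
    have h2 := add_smul_mem_of_le hK hx' hr' hd' hm.le (min_le_right _ _)
    refine ⟨(1 / 2 : ℝ) • x + (1 / 2 : ℝ) • x', hK hx hx' (by norm_num) (by norm_num)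
      (by norm_num), min r r' / 2, half_pos hm, ?_⟩
    have h3 := hK h1 h2 (by norm_num : (0 : ℝ) ≤ 1 / 2) (by norm_num : (0 : ℝ) ≤ 1 / 2)
      (by norm_num)
    convert h3 using 1
    module
  | smul c d _ h =>
    obtain ⟨x, hx, r, hr, hd⟩ := h
    rcases lt_trichotomy c 0 with hc | rfl | hc
    · refine ⟨x + r • d, hd, r / (-c), div_pos hr (by linarith), ?_⟩
      have : x + r • d + (r / (-c)) • c • d = x := by
        rw [smul_smul, div_neg, neg_mul, div_mul_cancel₀ _ hc.ne, neg_smul, add_assoc,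
          add_neg_cancel, add_zero]
      rwa [this]
    · exact ⟨x, hx, 1, one_pos, by rwa [zero_smul, smul_zero, add_zero]⟩
    · refine ⟨x, hx, r / c, div_pos hr hc, ?_⟩
      rwa [smul_smul, div_mul_cancel₀ _ hc.ne']

/-- Finitely many directions are available at a common point and at a common scale. -/
theorem exists_forall_add_smul_mem (hK : Convex ℝ K) (hne : K.Nonempty) {F : Set E}
    (hF : F.Finite) (hFK : F ⊆ directions K) :
    ∃ x ∈ K, ∃ r : ℝ, 0 < r ∧ ∀ d ∈ F, x + r • d ∈ K := by
  induction F, hF using Set.Finite.induction_on with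
  | empty =>
    obtain ⟨x, hx⟩ := hne
    exact ⟨x, hx, 1, one_pos, by simp⟩
  | @insert d₀ F _ _ ih =>
    obtain ⟨x, hx, r, hr, h1⟩ := ih ((Set.subset_insert _ _).trans hFK)
    obtain ⟨x', hx', r', hr', h2⟩ := exists_add_smul_mem hK hne (hFK (Set.mem_insert _ _))
    have hm : 0 < min r r' := lt_min hr hr'
    refine ⟨(1 / 2 : ℝ) • x + (1 / 2 : ℝ) • x', hK hx hx' (by norm_num) (by norm_num)
      (by norm_num), min r r' / 2, half_pos hm, ?_⟩
    rintro d (rfl | hd)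
    · have h3 := hK hx (add_smul_mem_of_le hK hx' hr' h2 hm.le (min_le_right _ _))
        (by norm_num : (0 : ℝ) ≤ 1 / 2) (by norm_num : (0 : ℝ) ≤ 1 / 2) (by norm_num)
      convert h3 using 1
      module
    · have h3 := hK (add_smul_mem_of_le hK hx hr (h1 d hd) hm.le (min_le_left _ _)) hx'
        (by norm_num : (0 : ℝ) ≤ 1 / 2) (by norm_num : (0 : ℝ) ≤ 1 / 2) (by norm_num)
      convert h3 using 1
      module

/-- A generating set may lie in a hyperplane that misses `0`. Its directions are then dense only in
the kernel of a functional. -/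
theorem exists_functional_directions (hne : K.Nonempty) (hgen : IsGenerating K) :
    ∃ (φ : E →L[ℝ] ℝ) (g : E), ∀ z, z - φ z • g ∈ (directions K).topologicalClosure := by
  set H := (directions K).topologicalClosure with hH
  obtain ⟨x₀, hx₀⟩ := hne
  have hsub : ∀ x ∈ K, x - x₀ ∈ H := fun x hx =>
    Submodule.le_topologicalClosure _ (Submodule.subset_span ⟨x₀, hx₀, x, hx, rfl⟩)
  have htop : H ⊔ Submodule.span ℝ {x₀} = ⊤ := by
    have hcl : IsClosed ((H ⊔ Submodule.span ℝ {x₀} : Submodule ℝ E) : Set E) :=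
      Submodule.isClosed_sup_finiteDimensional H _ (Submodule.isClosed_topologicalClosure _)
    rw [eq_top_iff, ← hgen]
    refine Submodule.topologicalClosure_minimal _ (Submodule.span_le.2 fun x hx => ?_) hcl
    have := Submodule.add_mem_sup (hsub x hx) (Submodule.mem_span_singleton_self (R := ℝ) x₀)
    rwa [sub_add_cancel] at this
  by_cases hx : x₀ ∈ H
  · refine ⟨0, 0, fun z => ?_⟩
    have h1 : H = ⊤ := by
      rw [← htop, eq_comm, sup_eq_left, Submodule.span_singleton_le_iff_mem]
      exact hx
    rw [h1]
    trivial
  · obtain ⟨f, hf, hfH⟩ := Submodule.exists_le_ker_of_notMem hx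
    have hdec : ∀ z, z - (f z / f x₀) • x₀ ∈ H := by
      intro z
      have hz : z ∈ H ⊔ Submodule.span ℝ {x₀} := by rw [htop]; trivial
      obtain ⟨y, hy, w, hw, rfl⟩ := Submodule.mem_sup.1 hz
      obtain ⟨c, rfl⟩ := Submodule.mem_span_singleton.1 hw
      have h1 : f y = 0 := hfH hy
      rw [map_add, h1, zero_add, map_smul, smul_eq_mul, mul_div_cancel_right₀ _ hf,
        add_sub_cancel_right]
      exact hy
    have hker : LinearMap.ker f = H := by
      refine le_antisymm (fun z hz => ?_) hfH
      have := hdec z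
      rwa [LinearMap.mem_ker.1 hz, zero_div, zero_smul, sub_zero] at this
    have hcont : Continuous f := LinearMap.continuous_of_isClosed_ker f
      (by rw [hker]; exact Submodule.isClosed_topologicalClosure _)
    refine ⟨(f x₀)⁻¹ • ⟨f, hcont⟩, x₀, fun z => ?_⟩
    have := hdec z
    rwa [div_eq_inv_mul] at this

end Directions

/-! ### Exposers inside a hyperplane, and the conclusion -/

section Conclusion

variable {δ M Δ : ℝ} {e : ℕ+ → LInf ℕ+}

/-- For every functional `φ` the parameters of the exposers can be chosen such that `φ` is small on
all of them: one of `U_1`, `U_2` is corrected by a multiple of the other, and the rest consists of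
differences of generators with almost equal values of `φ`. -/
theorem exists_exposers_near_ker (h : Admissible δ M Δ) (he : IsL1Basis e)
    (φ : X δ M Δ e →L[ℝ] ℝ) {ε : ℝ} (hε : 0 < ε) :
    ∃ (P Q : Fin 2) (a : ℝ) (N N' : ℕ+), ((N : ℕ) + 1) % 2 = P ∧ (N : ℕ) % 2 = Q ∧
      (N' : ℕ) % 2 = (N : ℕ) % 2 ∧ N' < N ∧ |a| ≤ 1 ∧
      ∀ z ∈ exposers δ M Δ e P Q a N N', |φ z| ≤ ε := by
  obtain ⟨P, Q, hPQ, hle⟩ : ∃ P Q : Fin 2, ((Q : ℕ) + 1) % 2 = P ∧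
      |φ (uX δ M Δ e P)| ≤ |φ (uX δ M Δ e Q)| := by
    rcases le_total |φ (uX δ M Δ e 0)| |φ (uX δ M Δ e 1)| with h1 | h1
    · exact ⟨0, 1, rfl, h1⟩
    · exact ⟨1, 0, rfl, h1⟩
  set a : ℝ := -(φ (uX δ M Δ e P) / φ (uX δ M Δ e Q)) with ha
  have ha1 : |a| ≤ 1 := by
    rw [ha, abs_neg, abs_div]
    exact div_le_one_of_le₀ hle (abs_nonneg _)
  have hφU : φ (uX δ M Δ e P + a • uX δ M Δ e Q) = 0 := by
    rw [map_add, map_smul, smul_eq_mul, ha]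
    by_cases h0 : φ (uX δ M Δ e Q) = 0
    · rw [h0, abs_zero] at hle
      rw [h0, mul_zero, add_zero]
      exact abs_eq_zero.1 (le_antisymm hle (abs_nonneg _))
    · field_simp
      ring
  let f : ℕ → ℕ+ := fun m => ⟨2 * m + 2 + Q, by omega⟩
  have hf : ∀ m, (f m : ℕ) = 2 * m + 2 + Q := fun m => rfl
  let c : ℕ → ℝ × ℝ := fun m => (φ (yX δ M Δ e (f m)), φ (vX δ M Δ e 0 (f m + 1)))
  have hφle : ∀ x : X δ M Δ e, ‖x‖ ≤ 1 → ‖φ x‖ ≤ ‖φ‖ := fun x hx =>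
    (φ.le_opNorm x).trans (mul_le_of_le_one_right φ.opNorm_nonneg hx)
  have hc : ∀ m, c m ∈ Metric.closedBall (0 : ℝ × ℝ) ‖φ‖ := by
    intro m
    rw [mem_closedBall_zero_iff, Prod.norm_def, max_le_iff]
    constructor
    · refine hφle _ ((norm_add_le _ _).trans ?_)
      linarith [norm_vX_le h he 0 (f m), norm_vX_le h he 1 (f m)]
    · exact hφle _ (by linarith [norm_vX_le h he 0 (f m + 1)])
  obtain ⟨l, -, ψ, hψ, hlim⟩ := (isCompact_closedBall (0 : ℝ × ℝ) ‖φ‖).tendsto_subseq hc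
  obtain ⟨m₀, hm₀⟩ := Metric.cauchySeq_iff.1 hlim.cauchySeq ε hε
  have hd : dist (c (ψ (m₀ + 1))) (c (ψ m₀)) < ε := hm₀ (m₀ + 1) (Nat.le_succ _) m₀ le_rfl
  have hlt : ψ m₀ < ψ (m₀ + 1) := hψ (Nat.lt_succ_self m₀)
  rw [Prod.dist_eq, max_lt_iff, Real.dist_eq, Real.dist_eq] at hd
  obtain ⟨hd1, hd2⟩ := hd
  set N := f (ψ (m₀ + 1)) with hN
  set N' := f (ψ m₀) with hN'
  have hNv := hf (ψ (m₀ + 1))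
  have hN'v := hf (ψ m₀)
  rw [← hN] at hNv
  rw [← hN'] at hN'v
  have hQ2 := Q.isLt
  have hpeak : ∀ n n' : ℕ+, |φ (yX δ M Δ e n) - φ (yX δ M Δ e n')| < ε →
      ∀ k ∈ Finset.Icc 1 8, |φ (peak δ M Δ e P Q a n n' k)| ≤ ε := by
    intro n n' hnn k hk
    have ht1 := h.third_lt_tk hk
    have ht2 := h.tk_lt_half hk
    rw [peak, map_add, map_smul, hφU, smul_zero, zero_add, map_smul, map_sub, smul_eq_mul,
      abs_mul, abs_of_pos (by linarith : 0 < tk M k / 2)]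
    exact (mul_le_of_le_one_left (abs_nonneg _) (by linarith)).trans hnn.le
  refine ⟨P, Q, a, N, N', by omega, by omega, by omega, ?_, ha1, ?_⟩
  · rw [← PNat.coe_lt_coe]
    omega
  rintro z (rfl | ⟨k, hk, rfl⟩ | ⟨k, hk, rfl⟩)
  · rw [map_sub]
    exact hd2.le
  · exact hpeak N N' hd1 k hk
  · exact hpeak N' N (by rwa [abs_sub_comm]) k hk

/-- Blowing up `K` around one of its points. -/
theorem NearContraction.rescale {κ r : ℝ} {K : Set (X δ M Δ e)} {R : X δ M Δ e → X δ M Δ e}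
    (hK : Convex ℝ K) (hR : ∀ x, R x ∈ K) (hκ : ∀ x, ∀ y ∈ K, ‖R x - y‖ ≤ (1 + κ) * ‖x - y‖)
    {x₀ : X δ M Δ e} (hx₀ : x₀ ∈ K) (hr : 0 < r) :
    NearContraction κ {y | x₀ + r • y ∈ K} fun y => r⁻¹ • (R (x₀ + r • y) - x₀) where
  convex := by
    intro y hy y' hy' s t hs ht hst
    have h1 := hK hy hy' hs ht hst
    have h2 : x₀ + r • (s • y + t • y') = s • (x₀ + r • y) + t • (x₀ + r • y') := by
      have h3 : x₀ = (s + t) • x₀ := by rw [hst, one_smul]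
      nth_rewrite 1 [h3]
      module
    change x₀ + r • (s • y + t • y') ∈ K
    rwa [h2]
  zero_mem := by simpa using hx₀
  mem y := by
    change x₀ + r • r⁻¹ • (R (x₀ + r • y) - x₀) ∈ K
    rw [smul_smul, mul_inv_cancel₀ hr.ne', one_smul, add_sub_cancel]
    exact hR _
  norm_sub_le x y hy := by
    have h1 := hκ (x₀ + r • x) _ hy
    have h2 : r⁻¹ • (R (x₀ + r • x) - x₀) - y = r⁻¹ • (R (x₀ + r • x) - (x₀ + r • y)) := by
      rw [← sub_sub, smul_sub r⁻¹ _ (r • y), smul_smul, inv_mul_cancel₀ hr.ne', one_smul]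
    have h3 : x₀ + r • x - (x₀ + r • y) = r • (x - y) := by module
    rw [h3, norm_smul, Real.norm_eq_abs, abs_of_pos hr] at h1
    rw [h2, norm_smul, Real.norm_eq_abs, abs_of_pos (inv_pos.2 hr)]
    calc r⁻¹ * ‖R (x₀ + r • x) - (x₀ + r • y)‖ ≤ r⁻¹ * ((1 + κ) * (r * ‖x - y‖)) :=
          mul_le_mul_of_nonneg_left h1 (inv_pos.2 hr).le
      _ = (1 + κ) * ‖x - y‖ := by
          field_simp

theorem isCompact_rescale {E : Type*} [NormedAddCommGroup E] [NormedSpace ℝ E] {K : Set E}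
    (hK : IsCompact K) (x₀ : E) {r : ℝ} (hr : 0 < r) : IsCompact {y | x₀ + r • y ∈ K} := by
  have h1 : {y | x₀ + r • y ∈ K} = (fun x => r⁻¹ • (x - x₀)) '' K := by
    ext y
    constructor
    · intro hy
      refine ⟨_, hy, ?_⟩
      dsimp only
      rw [add_sub_cancel_left, smul_smul, inv_mul_cancel₀ hr.ne', one_smul]
    · rintro ⟨x, hx, rfl⟩
      change x₀ + r • r⁻¹ • (x - x₀) ∈ K
      rwa [smul_smul, mul_inv_cancel₀ hr.ne', one_smul, add_sub_cancel]
  rw [h1]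
  exact hK.image (by fun_prop)

/-- If `z` is close to the closure of a subspace up to a small multiple of `g`, then `S z` is close
to the subspace. -/
theorem exists_near_smul_of_mem_closure {E : Type*} [NormedAddCommGroup E] [NormedSpace ℝ E]
    {D : Submodule ℝ E} {z g : E} {c ε S : ℝ} (hε : 0 < ε) (hS : 0 ≤ S)
    (hz : z - c • g ∈ D.topologicalClosure) (hc : |c| ≤ ε / (2 * (S + 1) * (‖g‖ + 1))) :
    ∃ d ∈ D, ‖d - S • z‖ ≤ ε := by
  have h1 : S • (z - c • g) ∈ closure (D : Set E) := Submodule.smul_mem _ _ hz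
  obtain ⟨d, hd, hdz⟩ := Metric.mem_closure_iff.1 h1 (ε / 2) (half_pos hε)
  refine ⟨d, hd, ?_⟩
  have h2 : d - S • z = -(S • (z - c • g) - d) - (S * c) • g := by
    rw [smul_sub, smul_smul]
    abel
  have hg := norm_nonneg g
  have h3 : ‖(S * c) • g‖ ≤ ε / 2 := by
    rw [norm_smul, norm_mul, Real.norm_eq_abs, Real.norm_eq_abs, abs_of_nonneg hS]
    rw [le_div_iff₀ (by positivity)] at hc
    have h4 : S * |c| * ‖g‖ ≤ (S + 1) * |c| * (‖g‖ + 1) := by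
      have := abs_nonneg c
      gcongr <;> linarith
    linarith
  rw [dist_eq_norm] at hdz
  rw [h2]
  refine (norm_sub_le _ _).trans ?_
  rw [norm_neg]
  linarith

theorem exists_no_retraction (h : Admissible δ M Δ) (he : IsL1Basis e) :
    ∃ l : ℝ≥0, 1 < l ∧ ∀ K : Set (X δ M Δ e), IsCompact K → Convex ℝ K → IsGenerating K →
      ¬ ∃ R : X δ M Δ e → X δ M Δ e, IsRetractionOnto R K ∧ LipschitzWith l R := by
  obtain ⟨κ, ε, S, β, hκ, hε, hS, hβ1, hβ2, hβ3, hmain⟩ := exists_constants h he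
  refine ⟨1 + κ.toNNReal, by simpa using hκ, ?_⟩
  rintro K hKc hK hgen ⟨R, ⟨hRK, hRid⟩, hRl⟩
  have hne : K.Nonempty := ⟨R 0, hRK 0⟩
  have hRκ : ∀ x, ∀ y ∈ K, ‖R x - y‖ ≤ (1 + κ) * ‖x - y‖ := by
    intro x y hy
    have h1 := hRl.dist_le_mul x y
    rw [hRid y hy, dist_eq_norm, dist_eq_norm] at h1
    rwa [NNReal.coe_add, NNReal.coe_one, Real.coe_toNNReal _ hκ.le] at h1
  obtain ⟨φ, g, hφ⟩ := exists_functional_directions hne hgen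
  -- The tolerance is such that the correction `S φ(z) g` has norm at most `ε / 2`.
  obtain ⟨P, Q, a, N, N', hP, hQ, hNN', hlt, ha, hz⟩ :=
    exists_exposers_near_ker h he φ (ε := ε / (2 * (S + 1) * (‖g‖ + 1))) (by positivity)
  have happrox : ∀ z ∈ exposers δ M Δ e P Q a N N', ∃ d ∈ directions K, ‖d - S • z‖ ≤ ε := by
    intro z hzZ
    exact exists_near_smul_of_mem_closure hε hS (hφ z) (hz z hzZ)
  choose! d hdK hdz using happrox
  have hfin : (d '' exposers δ M Δ e P Q a N N' ∪
      (fun z => -d z) '' exposers δ M Δ e P Q a N N').Finite :=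
    ((finite_exposers P Q a N N').image _).union ((finite_exposers P Q a N N').image _)
  obtain ⟨x₀, hx₀, r, hr, hall⟩ := exists_forall_add_smul_mem hK hne hfin (by
    rintro _ (⟨z, hz, rfl⟩ | ⟨z, hz, rfl⟩)
    · exact hdK z hz
    · exact Submodule.neg_mem _ (hdK z hz))
  have H : Exposed κ ε S β P Q a N N' {y | x₀ + r • y ∈ K}
      fun y => r⁻¹ • (R (x₀ + r • y) - x₀) :=
    { toNearContraction := NearContraction.rescale hK hRK hRκ hx₀ hr
      parity_P := hP
      parity_Q := hQ
      parity_N' := hNN'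
      lt := hlt
      abs_le := ha
      kappa_nonneg := hκ.le
      eps_pos := hε
      S_nonneg := hS
      beta_le := hβ1
      beta_le' := hβ2
      one_le_beta := hβ3
      pos := fun z hz => ⟨d z, hall _ (Or.inl ⟨z, hz, rfl⟩), hdz z hz⟩
      neg' := fun z hz => ⟨-d z, hall _ (Or.inr ⟨z, hz, rfl⟩), by
        rw [← norm_neg, neg_add, neg_neg, ← sub_eq_add_neg]
        exact hdz z hz⟩ }
  refine not_isCompact_of_near h (N := N) (fun n hn => ?_) (isCompact_rescale hKc x₀ hr)
  obtain ⟨y, hy, hyn⟩ := hmain P Q a N N' _ _ H n hn 1 abs_one 0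
  exact ⟨y, hy, by rwa [one_smul] at hyn⟩

end Conclusion

end LipRetraction

end

/-- Admissible constants and isometric `ℓ₁`-sequences in `ℓ∞(ℕ)` exist, and for every choice of
them the space `X` is a separable Banach space such that, for some `l > 1`, there is no
`l`-Lipschitz retraction from `X` onto a generating compact convex subset of `X`. -/
theorem theorem2p1 :
    (∃ δ M Δ : ℝ, LipRetraction.Admissible δ M Δ) ∧
    (∃ e : ℕ+ → LipRetraction.LInf ℕ+, LipRetraction.IsL1Basis e) ∧
    ∀ δ M Δ : ℝ, LipRetraction.Admissible δ M Δ →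
      ∀ e : ℕ+ → LipRetraction.LInf ℕ+, LipRetraction.IsL1Basis e →
        CompleteSpace (LipRetraction.X δ M Δ e) ∧
        TopologicalSpace.SeparableSpace (LipRetraction.X δ M Δ e) ∧
        ∃ l : NNReal, 1 < l ∧
          ∀ K : Set (LipRetraction.X δ M Δ e),
            IsCompact K → Convex ℝ K → LipRetraction.IsGenerating K →
              ¬ ∃ R : LipRetraction.X δ M Δ e → LipRetraction.X δ M Δ e,
                LipRetraction.IsRetractionOnto R K ∧ LipschitzWith l R :=
  ⟨LipRetraction.exists_admissible, LipRetraction.exists_isL1Basis, fun δ M Δ h e he =>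
    ⟨LipRetraction.completeSpace_X δ M Δ e, LipRetraction.separableSpace_X δ M Δ e,
      LipRetraction.exists_no_retraction h he⟩⟩
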